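/- **Setting.** A *tree plan* is a pair $(\Gamma,\lambda)$, where $\Gamma$ is a finite set of finite sequences of natural numbers that contains the empty sequence $\langle\rangle$ and is closed under initial segments, and $\lambda:\Gamma\to\{1,\infty\}$ satisfies $\lambda(\langle\rangle)=1$. Put $I(\Gamma)=\{\sigma\in\Gamma:\lambda(\sigma)=\infty\}$. Let $S$ be a countably infinite set and $\star\notin S$. The tree $\Gamma(S)$ is the set of all finite sequences $\langle(i_0,t_0),\dots,(i_n,t_n)\rangle$ (including $\langle\rangle$) with $\langle i_0,\dots,i_n\rangle\in\Gamma$ such that, for each $k\le n$, $t_k=\star$ if $\lambda(\langle i_0,\dots,i_k\rangle)=1$ and $t_k\in S$ if $\lambda(\langle i_0,\dots,i_k\rangle)=\infty$. Let $\pi:\Gamma(S)\to\Gamma$ be the map $\langle(i_0,t_0),\dots,(i_n,t_n)\rangle\mapsto\langle i_0,\dots,i_n\rangle$. View $\Gamma(S)$ as a structure in the language $\mathcal L_\Gamma=\{\le,\varepsilon,\sqcap,\mathrm{pred}\}\cup\{P_\sigma:\sigma\in\Gamma\}$, where $\le$ is sequence extension, $\varepsilon=\langle\rangle$ is the root, $\sqcap$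 is the meet, $\mathrm{pred}$ deletes the last entry (and $\mathrm{pred}(\varepsilon)=\varepsilon$), and $P_\sigma=\pi^{-1}(\sigma)$. For $a\in\Gamma(S)$ let $M(a)=\{a':\mathrm{pred}(a')=\mathrm{pred}(a),\ \pi(a')=\pi(a)\}$ be the component of $a$. For $B\subseteq\Gamma(S)$ let $\mathrm{tcl}(B)$ be the smallest set that contains $\varepsilon$ and all $a\le b$ with $b\in B$, and contains every $a$ such that $\lambda(\pi(a))=1$ and $\mathrm{pred}(a)$ is in the set. **NIC structures.** Let $\mathcal M$ be an expansion of the $\mathcal L_\Gamma$-structure $\Gamma(S)$. For $e\in\Gamma(S)$ with $\pi(e)=\sigma\in I(\Gamma)$ and $b=\mathrm{pred}(e)$, let $\mathcal M(e)$ be the structure with universe $M(e)$ that has, for each $n>0$ and each type $p=\mathrm{tp}^{\mathcal M}(\mathrm{pred}(a_0),a_0,\dots,a_{n-1})$ with $\pi(a_0)=\sigma$ and $a_1,\dots,a_{n-1}\in M(a_0)$, the $n$-ary relation $R_p=\{\bar a\in M(e)^n:\mathcal M\models p(b,\bar a)\}$. Write $\mathrm{tp}_\Gamma$ for types in the $\mathcal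 L_\Gamma$-structure $\Gamma(S)$. An entailment $p\models q$ below means that every realization of $p$ is a realization of $q$. Then $\mathcal M$ is a *NIC structure* if the following hold. - **N1.** The theory of $\mathcal M$ is $\aleph_0$-categorical and eliminates quantifiers, and $\mathrm{acl}^{\mathcal M}(B)=\mathrm{tcl}(B)$ for all $B\subseteq\Gamma(S)$. - **N2.** For each $e\in\Gamma(S)$, $\mathrm{tp}_\Gamma(e)\models\mathrm{tp}^{\mathcal M}(e)$ (with realizations in $\Gamma(S)$). - **N3.** For each finite $C\subseteq\Gamma(S)$ and each $e\in\Gamma(S)$ with $\pi(e)\in I(\Gamma)$, $\mathrm{tp}_\Gamma(e/C)\cup\mathrm{tp}^{\mathcal M(e)}(e/\mathrm{tcl}(C)\cap M(e))\models\mathrm{tp}^{\mathcal M}(e/C)$ (with realizations in $M(e)$, since $\mathrm{tp}^{\mathcal M(e)}$ is a type in the structure $\mathcal M(e)$). **Theorem.** Let $(\Gamma,\lambda)$ be a tree plan and $S$ a countably infinite set. For each $\sigma\in I(\Gamma)$ let $T_\sigma$ be a theory in a countable relational language $\mathcal L_\sigma$ such that $T_\sigma$ is $\aleph_0$-categorical,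 eliminates quantifiers, is algebraically trivial (that is, $\mathrm{acl}^{\mathcal K}(A)=A$ for all $\mathcal K\models T_\sigma$ and all $A\subseteq K$), and has exactly one complete $1$-type over $\emptyset$; let $\mathcal N_\sigma\models T_\sigma$ be a countable model and $f_\sigma:S\to N_\sigma$ a bijection. The languages $\mathcal L_\sigma$ are taken to be pairwise disjoint. Let $\mathcal L^*$ be the language $\mathcal L_\Gamma$ together with a new $(n+1)$-ary relation symbol $\hat R$ for each $\sigma\in I(\Gamma)$ and each $n$-ary relation symbol $R$ of $\mathcal L_\sigma$. Let $\mathcal M$ be the expansion of $\Gamma(S)$ to $\mathcal L^*$ in which, for $\sigma=\sigma_0{}^\smallfrown k\in I(\Gamma)$ and each $n$-ary relation symbol $R$ of $\mathcal L_\sigma$, $$\hat R^{\mathcal M}=\{(b,\,b^\smallfrown(k,s_0),\dots,b^\smallfrown(k,s_{n-1})):\ \pi(b)=\sigma_0,\ s_0,\dots,s_{n-1}\in S,\ (f_\sigma(s_0),\dots,f_\sigma(s_{n-1}))\in R^{\mathcal N_\sigma}\}.$$ Then $\mathcal M$ is a NIC structure: it satisfies N1, N2 and N3. -/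

import Mathlib

open scoped FirstOrder

universe u v w

/-! ### General model theory -/

namespace NIC

section General

variable (L : FirstOrder.Language.{u, v}) {M : Type w} [L.Structure M]

/-- The model-theoretic algebraic closure: the union of the finite sets that are definable
with parameters from `A`. -/
def acl (A : Set M) : Set M :=
  {a | ∃ D : Set M, A.Definable₁ L D ∧ D.Finite ∧ a ∈ D}

/-- The type `tp(a/A)` of an element `a` over a set `A`, as a set of formulas with one free
variable and parameters from `A`. -/
def tp (A : Set M) (a : M) : Set (L[[A]].Formula (Fin 1)) :=
  {φ | φ.Realize (fun _ => a)}

variable {L}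

/-- The element `a` realizes the set `p` of formulas with parameters from `A`. -/
def Realizes {A : Set M} (p : Set (L[[A]].Formula (Fin 1))) (a : M) : Prop :=
  ∀ φ ∈ p, φ.Realize (fun _ => a)

/-- `T` eliminates quantifiers. -/
def EliminatesQuantifiers (T : L.Theory) : Prop :=
  ∀ (n : ℕ) (φ : L.Formula (Fin n)), ∃ ψ : L.Formula (Fin n),
    FirstOrder.Language.BoundedFormula.IsQF ψ ∧ T.Iff φ ψ

/-- `T` is algebraically trivial: `acl A = A` for all sets `A` in all models of `T`. -/
def AlgebraicallyTrivial (T : L.Theory) : Prop :=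
  ∀ (K : FirstOrder.Language.Theory.ModelType.{u, v, w} T) (A : Set K), acl L A = A

end General

/-! ### Longest common prefix of two lists -/

open Classical in
/-- The longest common prefix of two lists. -/
noncomputable def commonPrefix {α : Type w} : List α → List α → List α
  | a :: l, b :: m => if a = b then a :: commonPrefix l m else []
  | _, _ => []

theorem commonPrefix_prefix_left {α : Type w} :
    ∀ l m : List α, commonPrefix l m <+: l
  | [], m => by simp [commonPrefix]
  | a :: l, [] => by simp [commonPrefix]
  | a :: l, b :: m => by
    by_cases h : a = b
    · simpa [commonPrefix, h] using commonPrefix_prefix_left l m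
    · simp [commonPrefix, h]

end NIC

/-! ### Tree plans -/

/-- A tree plan `(Γ, λ)`: a finite set `Γ = nodes` of finite sequences of natural numbers which
contains the empty sequence and is closed under predecessors, with `λ : Γ → {1, ∞}` given by the
set `infNodes = λ⁻¹(∞)`; the root is not in it. The node `⟨i₀, …, iₙ⟩` is the list
`[i₀, …, iₙ]`. -/
structure TreePlan where
  nodes : Finset (List ℕ)
  nil_mem : [] ∈ nodes
  dropLast_mem : ∀ σ ∈ nodes, σ.dropLast ∈ nodes
  infNodes : Finset (List ℕ)
  infNodes_subset : infNodes ⊆ nodes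
  nil_notMem_infNodes : [] ∉ infNodes

namespace TreePlan

variable (Γ : TreePlan) (S : Type w)

theorem mem_of_prefix {σ τ : List ℕ} (h : σ <+: τ) (hτ : τ ∈ Γ.nodes) : σ ∈ Γ.nodes := by
  obtain ⟨ρ, rfl⟩ := h
  induction ρ using List.reverseRecOn with
  | nil => simpa using hτ
  | append_singleton ρ i ih =>
    apply ih
    have := Γ.dropLast_mem _ hτ
    rwa [← List.append_assoc, List.dropLast_concat] at this

/-- The condition for a finite sequence `⟨(i₀, t₀), …, (iₙ, tₙ)⟩` to be in `Γ(S)`; here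
`t = none` stands for `t = ⋆`. -/
def IsNode (l : List (ℕ × Option S)) : Prop :=
  l.map Prod.fst ∈ Γ.nodes ∧
    ∀ (k : ℕ) (hk : k < l.length),
      (l[k].2 ≠ none ↔ (l.map Prod.fst).take (k + 1) ∈ Γ.infNodes)

variable {Γ S} in
theorem IsNode.of_prefix {l m : List (ℕ × Option S)} (h : l <+: m) (hm : Γ.IsNode S m) :
    Γ.IsNode S l := by
  obtain ⟨r, rfl⟩ := h
  refine ⟨Γ.mem_of_prefix ?_ hm.1, fun k hk => ?_⟩
  · simp
  · have := hm.2 k (by simp; omega)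
    rw [List.getElem_append_left hk, List.map_append,
      List.take_append_of_le_length (by simp; omega)] at this
    exact this

/-- The tree `Γ(S)`. -/
def Node : Type w := {l : List (ℕ × Option S) // Γ.IsNode S l}

variable {Γ S}

namespace Node

/-- The projection `π : Γ(S) → Γ`. -/
def proj (a : Γ.Node S) : List ℕ := a.1.map Prod.fst

theorem proj_mem (a : Γ.Node S) : a.proj ∈ Γ.nodes := a.2.1

/-- The root `⟨⟩`. -/
def root : Γ.Node S := ⟨[], by simpa using Γ.nil_mem, by simp⟩

instance : Nonempty (Γ.Node S) := ⟨root⟩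

/-- The predecessor of a node; the root is its own predecessor. -/
def pred (a : Γ.Node S) : Γ.Node S := ⟨a.1.dropLast, a.2.of_prefix (List.dropLast_prefix _)⟩

/-- The meet of two nodes. -/
noncomputable def meet (a b : Γ.Node S) : Γ.Node S :=
  ⟨NIC.commonPrefix a.1 b.1, a.2.of_prefix (NIC.commonPrefix_prefix_left _ _)⟩

/-- The tree order: `b` extends `a`. -/
instance : LE (Γ.Node S) := ⟨fun a b => a.1 <+: b.1⟩

end Node

/-! ### Tree closure -/

/-- The stages `tcl₀(B) ⊆ tcl₁(B) ⊆ …` of the tree closure. -/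
def tclStage (B : Set (Γ.Node S)) : ℕ → Set (Γ.Node S)
  | 0 => {Node.root} ∪ {a | ∃ b ∈ B, a ≤ b}
  | n + 1 => tclStage B n ∪ {a | a.proj ∉ Γ.infNodes ∧ a.pred ∈ tclStage B n}

/-- The tree closure of a set of nodes. -/
def tcl (B : Set (Γ.Node S)) : Set (Γ.Node S) := ⋃ n, tclStage B n

/-! ### The language of `Γ` and the structure `Γ(S)` -/

/-- The function symbols `ε`, `pred`, `⊓` of the language of trees. -/
inductive TreeFunction : ℕ → Type
  | root : TreeFunction 0
  | pred : TreeFunction 1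
  | meet : TreeFunction 2

variable (Γ) in
/-- The relation symbols `≤` and `P_σ` for `σ ∈ Γ`. -/
inductive TreeRelation : ℕ → Type
  | le : TreeRelation 2
  | P (σ : Γ.nodes) : TreeRelation 1

variable (Γ) in
/-- The language `L_Γ`. -/
def lang : FirstOrder.Language.{0, 0} := ⟨TreeFunction, Γ.TreeRelation⟩

/-- `Γ(S)` as an `L_Γ`-structure. -/
noncomputable instance : Γ.lang.Structure (Γ.Node S) where
  funMap {_} F x :=
    match F, x with
    | .root, _ => Node.root
    | .pred, x => (x 0).pred
    | .meet, x => (x 0).meet (x 1)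
  RelMap {_} R x :=
    match R, x with
    | .le, x => x 0 ≤ x 1
    | .P σ, x => (x 0).proj = σ

/-! ### Components of an expansion of `Γ(S)` -/

/-- The component `M(a)` of a node `a`. -/
def component (a : Γ.Node S) : Set (Γ.Node S) :=
  {a' | a'.pred = a.pred ∧ a'.proj = a.proj}

section Expansion

variable (L : FirstOrder.Language.{u, v}) [L.Structure (Γ.Node S)]

/-- The set `S_n^σ` (for `n > 0`) of all types `tp(b, a₀, …, aₙ₋₁)` where `π(a₀) = σ`,
`b = pred(a₀)` and all `aᵢ` are in the component of `a₀`. -/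
def componentTypes (σ : List ℕ) (n : ℕ) :
    Set ((L.completeTheory (Γ.Node S)).CompleteType (Fin (n + 1))) :=
  {p | ∃ (hn : 0 < n) (a : Fin n → Γ.Node S),
    (a ⟨0, hn⟩).proj = σ ∧ (∀ i, a i ∈ component (a ⟨0, hn⟩)) ∧
    p = FirstOrder.Language.Theory.typeOf _
      (Fin.cons (a ⟨0, hn⟩).pred a : Fin (n + 1) → Γ.Node S)}

variable (Γ S) in
/-- The relational language with an `n`-ary symbol `R_p` for each `p ∈ S_n^σ`, `n > 0`. -/
def componentLang (σ : List ℕ) : FirstOrder.Language :=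
  ⟨fun _ => PEmpty.{1}, fun n => {p // p ∈ componentTypes (Γ := Γ) (S := S) L σ n}⟩

/-- The structure `M(e)` on the component of `e`: the symbol `R_p` holds at `x` if
`M ⊨ p(b, x)` with `b = pred(e)`, that is, if `p` is the type of `(b, x)`. -/
instance componentStructure (e : Γ.Node S) :
    (componentLang Γ S L e.proj).Structure (component e) where
  funMap F _ := F.elim
  RelMap p x := FirstOrder.Language.Theory.typeOf (L.completeTheory (Γ.Node S))
    (Fin.cons e.pred (fun i => (x i : Γ.Node S)) : Fin _ → Γ.Node S) = p.1

end Expansion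

theorem self_mem_component (e : Γ.Node S) : e ∈ component e := ⟨rfl, rfl⟩

/-- Nil-interaction coordinatized structures: an `L`-structure `M` with universe `Γ(S)`, where `L`
contains `L_Γ` through `ι`, is a NIC structure if it is an expansion of `Γ(S)` and satisfies the
conditions N1, N2 and N3. An entailment between types means that each realization of the first
one is a realization of the second one. In N3 the realizations are elements of the structure `M(e)`,
since `tp^{M(e)}` is a type in that structure. -/
structure IsNIC {L : FirstOrder.Language.{u, v}} (ι : Γ.lang →ᴸ L) (M : L.Structure (Γ.Node S)) :
    Prop where
  injective : ι.Injective
  isExpansion : ι.IsExpansionOn (Γ.Node S)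
  categorical : Cardinal.Categorical (Cardinal.aleph0.{w}) (L.completeTheory (Γ.Node S))
  eliminatesQuantifiers : NIC.EliminatesQuantifiers (L.completeTheory (Γ.Node S))
  acl_eq_tcl : ∀ B : Set (Γ.Node S), NIC.acl L B = tcl B
  n2 : ∀ e e' : Γ.Node S,
    NIC.Realizes (NIC.tp Γ.lang ∅ e) e' → NIC.Realizes (NIC.tp L ∅ e) e'
  n3 : ∀ (C : Set (Γ.Node S)), C.Finite → ∀ e : Γ.Node S, e.proj ∈ Γ.infNodes →
    ∀ e' : component e,
      NIC.Realizes (NIC.tp Γ.lang C e) e'.1 →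
      NIC.Realizes (NIC.tp (componentLang Γ S L e.proj)
        {x : component e | x.1 ∈ tcl C} ⟨e, self_mem_component e⟩) e' →
      NIC.Realizes (NIC.tp L C e) e'.1

/-! ### The construction -/

section Construction

variable (Γ) (L : Γ.infNodes → FirstOrder.Language.{u, v})

/-- The new relation symbols: an `(n+1)`-ary symbol for each `n`-ary relation symbol of `L_σ`,
`σ ∈ I(Γ)`. Symbols that come from distinct `σ` are distinct. -/
inductive HatRelation : ℕ → Type v
  | hat (σ : Γ.infNodes) {n : ℕ} (R : (L σ).Relations n) : HatRelation (n + 1)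

/-- The language that consists of the new relation symbols. -/
def hatLang : FirstOrder.Language.{0, v} := ⟨fun _ => Empty, HatRelation Γ L⟩

/-- The language `L*`: the disjoint union of `L_Γ` and the new relation symbols. -/
abbrev starLang : FirstOrder.Language.{0, v} := Γ.lang.sum (hatLang Γ L)

variable {Γ} (N : Γ.infNodes → Type w) [∀ σ, (L σ).Structure (N σ)] (f : ∀ σ, S ≃ N σ)

/-- The interpretation of the new symbols: for `σ = σ₀⌢k`, the symbol that comes from `R` holds
exactly at the tuples `(b, b⌢(k, s₀), …, b⌢(k, sₙ₋₁))` with `π(b) = σ₀` such that `R` holds at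
`(f_σ(s₀), …, f_σ(sₙ₋₁))` in `N_σ`. -/
@[reducible] def hatStructure : (hatLang Γ L).Structure (Γ.Node S) where
  funMap F _ := F.elim
  RelMap {_} R x :=
    match R, x with
    | .hat (n := n) σ R, x => ∃ (k : ℕ) (s : Fin n → S),
        σ.1 = (x 0).proj ++ [k] ∧
        (∀ i, (x i.succ).1 = (x 0).1 ++ [(k, some (s i))]) ∧
        FirstOrder.Language.Structure.RelMap R (fun i => f σ (s i))

/-- The `L*`-structure with universe `Γ(S)` that is obtained by gluing copies of the structures
`N_σ` onto the components of `Γ(S)`. -/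
@[reducible] noncomputable def gluedStructure : (starLang Γ L).Structure (Γ.Node S) :=
  letI := hatStructure L N f
  FirstOrder.Language.sumStructure Γ.lang (hatLang Γ L) (Γ.Node S)

end Construction

end TreePlan

/-! ### Ultrapowers and elementary substructures -/

namespace NIC

open FirstOrder FirstOrder.Language

section ModelTheory

variable {L : FirstOrder.Language.{u, v}}

/-! The mechanism behind every clause is that the components do not interact. A new relation only
compares children of one node with one common index, so an arbitrary choice of an automorphism of `N
σ` for every node and every `σ` assembles into an automorphism of the glued structure
(`IsGlued.exists_aut`). If the `N σ` are homogeneous, it follows that a finite map between nodes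
extends to an automorphism as soon as it is closed under predecessors and respects projections,
equality and the new relations (`IsGlued.exists_aut_extending`).

Homogeneity of `N σ` is a back-and-forth argument. By quantifier elimination a finite partial
isomorphism preserves complete types, and the forth step is `ExtensionProperty`. Trivial algebraic
closure gives every formula in the type of a new point infinitely many solutions, so the type, moved
to the other tuple, is realized in an ultrapower outside any finite set. A countable elementary
substructure closed under witness functions inherits this, and by categoricity it is a copy of `N
σ`.

Categoricity: the tree axioms and the theories of the components are first-order, so the components
of a countable structure elementarily equivalent to the glued one are countable models of the `T σ`,
hence copies of the `N σ`. An isomorphism is then built node by node from the root. Quantifier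
elimination: a failure would yield, in a countable model, two tuples with the same quantifier-free
type and different types. That model is a copy of the glued structure, where the predecessor
closures of the tuples give a finite map that extends to an automorphism.

Algebraic closure: each element of `tcl B` is definable over `B`. A node outside `tcl B` lies at or
above a member of an infinite component that an automorphism fixing finitely many given parameters
can move away from any finite set. N2: the initial segments of two nodes with equal projection
correspond, a chain meets each component in at most one point, and there is a single 1-type. N3: the
relations `R_p` record the joint type of `e` with the finitely many siblings that lie below `C`, so
an automorphism of this one component moves `e` to `e'` and fixes `C`. -/

theorem forall_realize_iff {M K : Type*} [L.Structure M] [L.Structure K] (h : M ≅[L] K)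
    {α : Type*} [Finite α] (φ : L.Formula α) :
    (∀ v : α → M, φ.Realize v) ↔ ∀ v : α → K, φ.Realize v := by
  let ψ : L.Sentence := Formula.iAlls α (φ.relabel (Sum.inr : α → Empty ⊕ α))
  have key : ∀ (A : Type _) [L.Structure A], A ⊨ ψ ↔ ∀ v : α → A, φ.Realize v := by
    intro A _
    simp only [ψ, Sentence.Realize, Formula.realize_iAlls, Formula.realize_relabel]
    rfl
  -- The same statement at a second universe level, for `K`.
  have key' : ∀ (A : Type _) [L.Structure A], A ⊨ ψ ↔ ∀ v : α → A, φ.Realize v := by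
    intro A _
    simp only [ψ, Sentence.Realize, Formula.realize_iAlls, Formula.realize_relabel]
    rfl
  rw [← key, ← key', h.realize_sentence]

/-- The ultrapower of `N` with respect to a nonprincipal ultrafilter on `ℕ`. -/
abbrev Ultrapower (N : Type w) : Type w :=
  ((Filter.hyperfilter ℕ : Ultrafilter ℕ) : Filter ℕ).Product (fun _ => N)

theorem elementarilyEquivalent_ultrapower (N : Type w) [L.Structure N] [Nonempty N] :
    N ≅[L] Ultrapower N := by
  rw [elementarilyEquivalent_iff]
  intro φ
  rw [Ultraproduct.sentence_realize]
  simp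

/-- This is countable saturation of the ultrapower, by diagonalization: coordinate `i` of the
solution satisfies as many of the first formulas as coordinate `i` allows, up to the bound `i`. -/
theorem exists_realize_of_finitely_realizable (N : Type w) [L.Structure N] [Nonempty N]
    (Φ : Set (L.Formula (Ultrapower N ⊕ Unit))) (hΦ : Φ.Countable)
    (h : ∀ F : Finset (L.Formula (Ultrapower N ⊕ Unit)), ↑F ⊆ Φ →
      ∃ x : Ultrapower N, ∀ φ ∈ F, φ.Realize (Sum.elim id fun _ => x)) :
    ∃ x : Ultrapower N, ∀ φ ∈ Φ, φ.Realize (Sum.elim id fun _ => x) := by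
  classical
  rcases Φ.eq_empty_or_nonempty with rfl | hne
  · simp
  obtain ⟨φ, rfl⟩ := hΦ.exists_eq_range hne
  let cast : (ℕ → N) → Ultrapower N := Quotient.mk _
  have hcast : ∀ x : Ultrapower N, ∃ a : ℕ → N, cast a = x := Quotient.exists_rep
  choose rep hrep using hcast
  have los : ∀ (ψ : L.Formula (Ultrapower N ⊕ Unit)) (y : ℕ → N),
      ψ.Realize (Sum.elim id fun _ => cast y) ↔
        ∀ᶠ i in (Filter.hyperfilter ℕ : Filter ℕ),
          ψ.Realize (Sum.elim (fun p => rep p i) fun _ => y i) := by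
    intro ψ y
    have := Ultraproduct.realize_formula_cast (M := fun _ : ℕ => N)
      (u := Filter.hyperfilter ℕ) ψ (Sum.elim rep fun _ => y)
    convert! this using 2
    · ext (p | p)
      · exact (hrep p).symm
      · rfl
    · ext i
      congr! 1
      ext (p | p) <;> rfl
  let X : ℕ → ℕ → Prop := fun n i =>
    ∃ y : N, ∀ k ≤ n, (φ k).Realize (Sum.elim (fun p => rep p i) fun _ => y)
  have hX : ∀ n, ∀ᶠ i in (Filter.hyperfilter ℕ : Filter ℕ), X n i := by
    intro n
    obtain ⟨x, hx⟩ := h ((Finset.range (n + 1)).image φ) (by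
      intro ψ hψ
      obtain ⟨k, -, rfl⟩ := Finset.mem_image.1 (Finset.mem_coe.1 hψ)
      exact ⟨k, rfl⟩)
    have : ∀ k ∈ Finset.range (n + 1), ∀ᶠ i in (Filter.hyperfilter ℕ : Filter ℕ),
        (φ k).Realize (Sum.elim (fun p => rep p i) fun _ => rep x i) := by
      intro k hk
      refine (los _ _).1 ?_
      rw [hrep]
      exact hx _ (Finset.mem_image_of_mem _ hk)
    rw [← Filter.eventually_all_finset] at this
    filter_upwards [this] with i hi
    exact ⟨rep x i, fun k hk => hi k (Finset.mem_range.2 (by omega))⟩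
  -- `Nat.findGreatest` returns 0 when no index works, hence the guard and the arbitrary default.
  have hy : ∀ i, ∃ y : N, X (Nat.findGreatest (fun n => X n i) i) i →
      ∀ k ≤ Nat.findGreatest (fun n => X n i) i,
        (φ k).Realize (Sum.elim (fun p => rep p i) fun _ => y) := by
    intro i
    by_cases hi : X (Nat.findGreatest (fun n => X n i) i) i
    · obtain ⟨y, hy⟩ := hi
      exact ⟨y, fun _ => hy⟩
    · exact ⟨Classical.arbitrary N, fun h => absurd h hi⟩
  choose y hy using hy
  refine ⟨cast y, ?_⟩
  rintro _ ⟨k, rfl⟩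
  rw [los]
  have hk : ∀ᶠ i in (Filter.hyperfilter ℕ : Filter ℕ), k ≤ i :=
    (Filter.hyperfilter_le_cofinite.trans Nat.cofinite_eq_atTop.le) (Filter.eventually_ge_atTop k)
  filter_upwards [hX k, hk] with i hi hki
  exact hy i (Nat.findGreatest_spec (P := fun n => X n i) hki hi) k
    (Nat.le_findGreatest hki hi)

/-- Finite tuples of the same type can be extended by elements of the same type, and there is an
extension outside of a given finite set if the extension is proper. -/
def ExtensionProperty (L : FirstOrder.Language.{u, v}) (K : Type w) [L.Structure K] : Prop :=
  ∀ (n : ℕ) (a a' : Fin n → K) (c : K) (E : Finset K),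
    (∀ φ : L.Formula (Fin n), φ.Realize a ↔ φ.Realize a') → c ∉ Set.range a →
    ∃ d ∉ E, ∀ φ : L.Formula (Fin n ⊕ Unit),
      φ.Realize (Sum.elim a fun _ => c) ↔ φ.Realize (Sum.elim a' fun _ => d)

theorem ExtensionProperty.of_equiv {K K' : Type*} [L.Structure K] [L.Structure K']
    (e : K ≃[L] K') (h : ExtensionProperty L K) : ExtensionProperty L K' := by
  classical
  intro n a a' c E haa hc
  obtain ⟨d, hd, H⟩ := h n (e.symm ∘ a) (e.symm ∘ a') (e.symm c) (E.image e.symm)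
    (fun φ => by simpa only [StrongHomClass.realize_formula] using haa φ) (by
      rintro ⟨i, hi⟩
      exact hc ⟨i, e.symm.injective hi⟩)
  refine ⟨e d, fun hE => hd (Finset.mem_image.2 ⟨_, hE, by simp⟩), fun φ => ?_⟩
  have := H φ
  rw [← StrongHomClass.realize_formula e, ← StrongHomClass.realize_formula e] at this
  convert! this using 2
  · ext (i | i) <;> simp
  · ext (i | i) <;> simp

/-- A finite solution set is definable over `a` and contains `c`, which would put `c` into the
algebraic closure of `a`. -/
theorem infinite_of_acl_eq {K : Type*} [L.Structure K]
    {n : ℕ} {a : Fin n → K} {c : K} (hacl : acl L (Set.range a) = Set.range a)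
    (hc : c ∉ Set.range a) {φ : L.Formula (Fin n ⊕ Unit)}
    (hφ : φ.Realize (Sum.elim a fun _ => c)) :
    {x : K | φ.Realize (Sum.elim a fun _ => x)}.Infinite := by
  intro hfin
  apply hc
  rw [← hacl]
  refine ⟨_, ?_, hfin, hφ⟩
  rw [Set.Definable₁, Set.definable_iff_exists_formula_sum]
  refine ⟨φ.relabel (Sum.map (fun i => ⟨a i, i, rfl⟩) fun _ => 0), ?_⟩
  ext x
  simp only [Set.mem_ofPred_eq, Formula.realize_relabel]
  congr! 1
  ext (i | i) <;> rfl

/-- For a fixed `m`, having all solutions among `m` elements is a first-order property of the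
parameters, so it passes from `a'` to `a`. -/
theorem infinite_of_same_type {K : Type*} [L.Structure K]
    {n : ℕ} {a a' : Fin n → K} (haa : ∀ φ : L.Formula (Fin n), φ.Realize a ↔ φ.Realize a')
    {φ : L.Formula (Fin n ⊕ Unit)}
    (h : {x : K | φ.Realize (Sum.elim a fun _ => x)}.Infinite) :
    {x : K | φ.Realize (Sum.elim a' fun _ => x)}.Infinite := by
  intro hfin
  have := hfin.to_subtype
  obtain ⟨m, ⟨e⟩⟩ := Finite.exists_equiv_fin {x : K | φ.Realize (Sum.elim a' fun _ => x)}
  let ψ : L.Formula (Fin n) := Formula.iExs (Fin m) (Formula.iAlls Unit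
    ((φ.relabel (Sum.map Sum.inl id)).imp (Formula.iSup fun j : Fin m =>
      ((Term.var (Sum.inr ()) : L.Term ((Fin n ⊕ Fin m) ⊕ Unit)).equal
        (Term.var (Sum.inl (Sum.inr j)))))))
  have key : ∀ b : Fin n → K, ψ.Realize b ↔ ∃ y : Fin m → K, ∀ x,
      φ.Realize (Sum.elim b fun _ => x) → ∃ j, x = y j := by
    intro b
    simp only [ψ, Formula.realize_iExs, Formula.realize_iAlls, Formula.realize_imp,
      Formula.realize_iSup, Formula.realize_equal, Formula.realize_relabel, Term.realize_var]
    refine exists_congr fun y => ⟨fun H x hx => ?_, fun H x hx => ?_⟩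
    · refine H (fun _ => x) ?_
      convert! hx using 1
      ext (i | i) <;> rfl
    · refine H (x ()) ?_
      convert! hx using 1
      ext (i | i) <;> rfl
  have h1 : ψ.Realize a' := (key a').2 ⟨fun j => (e.symm j).1, fun x hx =>
    ⟨e ⟨x, hx⟩, by simp⟩⟩
  obtain ⟨y, hy⟩ := (key a).1 ((haa ψ).2 h1)
  refine h ((Set.finite_range y).subset fun x hx => ?_)
  obtain ⟨j, rfl⟩ := hy x hx
  exact ⟨j, rfl⟩

/-- By saturation it suffices to satisfy finitely many formulas of the type of `c` over `a`, moved
to `a'`, together with inequalities to elements of `E`. The conjunction of these formulas has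
infinitely many solutions over `a`, hence over `a'`, and one of them avoids `E`. -/
theorem extensionProperty_ultrapower [Countable L.Symbols] (N : Type w) [L.Structure N]
    [Nonempty N] (hacl : ∀ A : Set (Ultrapower N), acl L A = A) :
    ExtensionProperty L (Ultrapower N) := by
  classical
  intro n a a' c E haa hc
  let Ψ : L.Formula (Fin n ⊕ Unit) → L.Formula (Ultrapower N ⊕ Unit) := fun φ =>
    φ.relabel (Sum.map a' id)
  let ne : Ultrapower N → L.Formula (Ultrapower N ⊕ Unit) := fun e =>
    ∼((Term.var (Sum.inr ())).equal (Term.var (Sum.inl e)))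
  have hΨ : ∀ φ x, (Ψ φ).Realize (Sum.elim id fun _ => x) ↔
      φ.Realize (Sum.elim a' fun _ => x) := by
    intro φ x
    simp only [Ψ, Formula.realize_relabel]
    congr! 1
    ext (i | i) <;> rfl
  have hne : ∀ e x, (ne e).Realize (Sum.elim id fun _ => x) ↔ x ≠ e := by
    intro e x
    simp [ne, Formula.realize_not, Formula.realize_equal]
  let Φ₀ : Set (L.Formula (Fin n ⊕ Unit)) := {φ | φ.Realize (Sum.elim a fun _ => c)}
  have hsat := exists_realize_of_finitely_realizable N (Ψ '' Φ₀ ∪ ne '' (E : Set _))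
    (((Set.to_countable _).image _).union ((Set.to_countable _).image _)) (by
      intro F hF
      have : ∃ φ ∈ Φ₀, ∀ x, φ.Realize (Sum.elim a' fun _ => x) →
          ∀ ψ ∈ F, ψ ∈ Ψ '' Φ₀ → ψ.Realize (Sum.elim id fun _ => x) := by
        -- Members of `F` that do not come from the type, that is, inequalities, contribute the
        -- trivial conjunct `⊤`.
        have hs : ∀ ψ : F, ∃ φ ∈ Φ₀, ψ.1 ∈ Ψ '' Φ₀ → Ψ φ = ψ.1 := by
          rintro ⟨ψ, hψ⟩
          by_cases h : ψ ∈ Ψ '' Φ₀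
          · obtain ⟨φ, h1, h2⟩ := h
            exact ⟨φ, h1, fun _ => h2⟩
          · exact ⟨⊤, Formula.realize_top.2 trivial, fun h' => absurd h' h⟩
        choose s hs1 hs2 using hs
        refine ⟨Formula.iInf s, Formula.realize_iInf.2 hs1, fun x hx ψ hψ h => ?_⟩
        rw [Formula.realize_iInf] at hx
        have := (hΨ _ x).2 (hx ⟨ψ, hψ⟩)
        rwa [hs2 ⟨ψ, hψ⟩ h] at this
      obtain ⟨φ, hφ, hF'⟩ := this
      obtain ⟨x, hx, hxE⟩ := (infinite_of_same_type haa
        (infinite_of_acl_eq (hacl _) hc hφ)).exists_notMem_finset E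
      refine ⟨x, fun ψ hψ => ?_⟩
      rcases hF hψ with h | ⟨e, he, rfl⟩
      · exact hF' x hx ψ hψ h
      · rw [hne]
        rintro rfl
        exact hxE he)
  obtain ⟨d, hd⟩ := hsat
  have hd1 : ∀ φ : L.Formula (Fin n ⊕ Unit), φ.Realize (Sum.elim a fun _ => c) →
      φ.Realize (Sum.elim a' fun _ => d) := fun φ hφ =>
    (hΨ φ d).1 (hd _ (Or.inl ⟨φ, hφ, rfl⟩))
  refine ⟨d, fun hE => ?_, fun φ => ⟨hd1 φ, fun h => ?_⟩⟩
  · exact (hne d d).1 (hd _ (Or.inr ⟨d, hE, rfl⟩)) rfl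
  · by_contra h'
    exact (Formula.realize_not.1 (hd1 (∼φ) (Formula.realize_not.2 h'))) h

end ModelTheory

end NIC

/-! ### Countable elementary substructures: the extension property and a test for quantifier
elimination. -/

namespace NIC

open FirstOrder FirstOrder.Language

section ModelTheory

variable {L : FirstOrder.Language.{u, v}}

theorem card_le_aleph0 [Countable L.Symbols] : L.card ≤ Cardinal.aleph0 :=
  Cardinal.mk_le_aleph0 (α := L.Symbols)

theorem exists_countable_elementarySubstructure [Countable L.Symbols] {U : Type w} [L.Structure U]
    (s : Set U) (hs : s.Countable) : ∃ S : L.ElementarySubstructure U, s ⊆ S ∧ Countable S := by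
  rcases finite_or_infinite U with hU | hU
  · exact ⟨⊤, by simp, inferInstance⟩
  · obtain ⟨S, hS, hc⟩ := exists_elementarySubstructure_card_eq L s Cardinal.aleph0.{w} le_rfl
      (by simpa using hs) (by simpa using card_le_aleph0) (by simp)
    refine ⟨S, hS, ?_⟩
    rw [← Cardinal.mk_le_aleph0_iff]
    simpa using hc.le

/-- Downward Löwenheim–Skolem in the language enlarged by the function symbols of `W`; the reduct
stays elementary by the Tarski–Vaught test. -/
theorem exists_elementarySubstructure_closed [Countable L.Symbols] (W : FirstOrder.Language.{0, 0})
    [Countable W.Symbols] {U : Type w} [L.Structure U] [W.Structure U] [Infinite U] :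
    ∃ S : L.ElementarySubstructure U, Cardinal.mk S = Cardinal.aleph0 ∧
      ∀ (k : ℕ) (F : W.Functions k) (x : Fin k → U), (∀ i, x i ∈ S) →
        Structure.funMap F x ∈ S := by
  have hcard : (L.sum W).card ≤ Cardinal.aleph0 := by
    rw [card_sum]
    refine (Cardinal.add_le_aleph0).2 ⟨?_, ?_⟩ <;> simpa using card_le_aleph0
  obtain ⟨S, -, hc⟩ := exists_elementarySubstructure_card_eq (L.sum W) (∅ : Set U)
    Cardinal.aleph0.{w} le_rfl (by simp) (by simpa using hcard) (by simp)
  let S' : L.Substructure U := (LHom.sumInl : L →ᴸ L.sum W).substructureReduct S.toSubstructure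
  have hS' : S'.IsElementary := by
    apply S'.isElementary_of_exists
    intro n φ x a h
    let φ' := (LHom.sumInl : L →ᴸ L.sum W).onBoundedFormula φ
    let x' : Fin n → S := x
    have h1 : φ'.ex.Realize (S.subtype ∘ (default : Empty → S)) (S.subtype ∘ x') := by
      rw [BoundedFormula.realize_ex]
      refine ⟨a, ?_⟩
      rw [LHom.realize_onBoundedFormula]
      convert! h using 1
    rw [S.subtype.map_boundedFormula, BoundedFormula.realize_ex] at h1
    obtain ⟨b, hb⟩ := h1
    refine ⟨b, ?_⟩
    rw [← S.subtype.map_boundedFormula, LHom.realize_onBoundedFormula, Fin.comp_snoc] at hb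
    convert! hb using 1
  refine ⟨⟨S', hS'⟩, Cardinal.lift_inj.1 hc, fun k F x hx => ?_⟩
  exact S.toSubstructure.fun_mem (Sum.inr F : (L.sum W).Functions k) x hx

/-- Function symbols for witnesses of the extension property. -/
def witnessLang : FirstOrder.Language.{0, 0} :=
  ⟨fun k => Σ n : ℕ, (Fin n → Fin k) × (Fin n → Fin k) × Fin k, fun _ => Empty⟩

instance : Countable witnessLang.Symbols := by
  have : ∀ k, Countable (witnessLang.Functions k) := fun k =>
    inferInstanceAs (Countable (Σ n : ℕ, (Fin n → Fin k) × (Fin n → Fin k) × Fin k))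
  have : ∀ k, Countable (witnessLang.Relations k) := fun k => inferInstanceAs (Countable Empty)
  exact inferInstanceAs (Countable
    ((Σ k, witnessLang.Functions k) ⊕ (Σ k, witnessLang.Relations k)))

/-- The witness `d` is made a function of the data. A symbol of arity `k` carries index maps that
read `a`, `a'` and `c` off one `k`-tuple, and its value avoids all entries of that tuple. Closure
under these functions keeps the witnesses inside the substructure. -/
theorem exists_elementarySubstructure_extensionProperty [Countable L.Symbols] {U : Type w}
    [L.Structure U] [Infinite U] (hU : ExtensionProperty L U) :
    ∃ S : L.ElementarySubstructure U, Cardinal.mk S = Cardinal.aleph0 ∧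
      ExtensionProperty L S := by
  classical
  have hw : ∀ (k : ℕ) (F : witnessLang.Functions k) (t : Fin k → U), ∃ d,
      (∀ φ : L.Formula (Fin F.1), φ.Realize (t ∘ F.2.1) ↔ φ.Realize (t ∘ F.2.2.1)) →
      t F.2.2.2 ∉ Set.range (t ∘ F.2.1) →
      d ∉ Finset.univ.image t ∧ ∀ φ : L.Formula (Fin F.1 ⊕ Unit),
        φ.Realize (Sum.elim (t ∘ F.2.1) fun _ => t F.2.2.2) ↔
          φ.Realize (Sum.elim (t ∘ F.2.2.1) fun _ => d) := by
    intro k F t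
    by_cases h : (∀ φ : L.Formula (Fin F.1), φ.Realize (t ∘ F.2.1) ↔ φ.Realize (t ∘ F.2.2.1)) ∧
      t F.2.2.2 ∉ Set.range (t ∘ F.2.1)
    · obtain ⟨d, hd⟩ := hU _ _ _ _ (Finset.univ.image t) h.1 h.2
      exact ⟨d, fun _ _ => hd⟩
    · exact ⟨t F.2.2.2, fun h1 h2 => absurd ⟨h1, h2⟩ h⟩
  choose G hG using hw
  let : witnessLang.Structure U := ⟨fun {k} F t => G k F t, fun R => R.elim⟩
  obtain ⟨S, hS, hcl⟩ := exists_elementarySubstructure_closed (L := L) witnessLang (U := U)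
  refine ⟨S, hS, ?_⟩
  intro n a a' c E haa hc
  -- The argument tuple lists `E` besides `a`, `a'` and `c`, so that avoiding its entries includes
  -- avoiding `E`.
  obtain ⟨m, ⟨e⟩⟩ := Finite.exists_equiv_fin ((Fin n ⊕ Fin n) ⊕ (Unit ⊕ E))
  let r : (Fin n ⊕ Fin n) ⊕ (Unit ⊕ E) → S :=
    Sum.elim (Sum.elim a a') (Sum.elim (fun _ => c) Subtype.val)
  let t : Fin m → U := fun i => r (e.symm i)
  let F : witnessLang.Functions m :=
    ⟨n, fun i => e (Sum.inl (Sum.inl i)), fun i => e (Sum.inl (Sum.inr i)), e (Sum.inr (Sum.inl ()))⟩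
  have h1 : t ∘ F.2.1 = (↑) ∘ a := by ext i; simp [t, F, r]
  have h2 : t ∘ F.2.2.1 = (↑) ∘ a' := by ext i; simp [t, F, r]
  have h3 : t F.2.2.2 = c := by simp [t, F, r]
  have hmap : ∀ {α : Type} (φ : L.Formula α) (x : α → S),
      φ.Realize (((↑) : S → U) ∘ x) ↔ φ.Realize x := fun φ x => S.subtype.map_formula φ x
  obtain ⟨hd, H⟩ := hG m F t (by
      rw [h1, h2]
      intro φ
      rw [hmap, hmap]
      exact haa φ) (by
      rw [h1, h3]
      rintro ⟨i, hi⟩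
      exact hc ⟨i, Subtype.ext hi⟩)
  refine ⟨⟨G m F t, hcl m F t fun i => (r (e.symm i)).2⟩, fun hE => hd ?_, fun φ => ?_⟩
  · refine Finset.mem_image.2 ⟨e (Sum.inr (Sum.inr ⟨_, hE⟩)), Finset.mem_univ _, ?_⟩
    simp [t, r]
  · have := H φ
    rw [h1, h2, h3] at this
    rw [← hmap, ← hmap]
    convert! this using 2
    · ext (i | i) <;> rfl
    · ext (i | i) <;> rfl

/-- The ultrapower of `N` is again a model of `T` and has the property; so does a countable
elementary substructure of it, which categoricity identifies with `N`. -/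
theorem extensionProperty_of_categorical [Countable L.Symbols] {T : L.Theory}
    (hcat : Cardinal.Categorical (Cardinal.aleph0.{w}) T)
    (hacl : AlgebraicallyTrivial.{u, v, w} T) (N : Type w) [L.Structure N] [hT : N ⊨ T]
    [Countable N] [Infinite N] : ExtensionProperty L N := by
  have hU := elementarilyEquivalent_ultrapower (L := L) N
  have hUT : Ultrapower N ⊨ T := hU.theory_model_iff.1 hT
  have hUi : Infinite (Ultrapower N) := hU.infinite_iff.1 inferInstance
  obtain ⟨S, hS, hSe⟩ := exists_elementarySubstructure_extensionProperty
    (extensionProperty_ultrapower N fun A => hacl (Theory.ModelType.of T (Ultrapower N)) A)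
  obtain ⟨e⟩ := hcat (Theory.ModelType.of T S) (Theory.ModelType.of T N) hS (by simp)
  exact hSe.of_equiv e

/-- If `φ` has no quantifier-free equivalent, then for each `m` two tuples of `M` agree on the first
`m` quantifier-free formulas and disagree on `φ`. Their classes in the ultrapower agree on all
quantifier-free formulas and still disagree on `φ`, and a countable elementary substructure contains
both. -/
theorem eliminatesQuantifiers_of_countable [Countable L.Symbols] (M : Type w) [L.Structure M]
    [Nonempty M]
    (h : ∀ (K : Type w) [L.Structure K], Countable K → M ≅[L] K → ∀ (n : ℕ) (a a' : Fin n → K),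
      (∀ ψ : L.Formula (Fin n), BoundedFormula.IsQF ψ → (ψ.Realize a ↔ ψ.Realize a')) →
      ∀ φ : L.Formula (Fin n), φ.Realize a → φ.Realize a') :
    EliminatesQuantifiers (L.completeTheory M) := by
  classical
  intro n φ
  by_contra! hφ
  have hne : Nonempty {ψ : L.Formula (Fin n) // BoundedFormula.IsQF ψ} := ⟨⟨⊥, .falsum⟩⟩
  obtain ⟨ψ, hψ⟩ := exists_surjective_nat {ψ : L.Formula (Fin n) // BoundedFormula.IsQF ψ}
  have key : ∀ m : ℕ, ∃ a a' : Fin n → M, φ.Realize a ∧ ¬ φ.Realize a' ∧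
      ∀ k < m, (ψ k).1.Realize a ↔ (ψ k).1.Realize a' := by
    intro m
    by_contra! hm
    let pat : (Fin n → M) → Set (Fin m) := fun a => {k | (ψ k).1.Realize a}
    let lit : Set (Fin m) → Fin m → L.Formula (Fin n) := fun p k =>
      if k ∈ p then (ψ k).1 else ∼(ψ k).1
    let I := {p : Set (Fin m) // ∃ a, φ.Realize a ∧ pat a = p}
    -- If the first `m` formulas decided `φ`, then `φ` would be the disjunction of the finitely many
    -- truth patterns that its realizations show.
    let θ : L.Formula (Fin n) := Formula.iSup fun p : I => Formula.iInf fun k => lit p.1 k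
    have hθ : BoundedFormula.IsQF θ := by
      have sup : ∀ l : List (L.Formula (Fin n)), (∀ χ ∈ l, BoundedFormula.IsQF χ) →
          BoundedFormula.IsQF (List.foldr (· ⊔ ·) (⊥ : L.Formula (Fin n)) l) := by
        intro l hl
        induction l with
        | nil => exact .falsum
        | cons x l ih =>
          exact (hl x (by simp)).sup (ih fun χ hχ => hl χ (by simp [hχ]))
      have inf : ∀ l : List (L.Formula (Fin n)), (∀ χ ∈ l, BoundedFormula.IsQF χ) →
          BoundedFormula.IsQF (List.foldr (· ⊓ ·) (⊤ : L.Formula (Fin n)) l) := by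
        intro l hl
        induction l with
        | nil => exact .top
        | cons x l ih =>
          exact (hl x (by simp)).inf (ih fun χ hχ => hl χ (by simp [hχ]))
      refine sup _ fun χ hχ => ?_
      obtain ⟨p, -, rfl⟩ := List.mem_map.1 hχ
      refine inf _ fun χ hχ => ?_
      obtain ⟨k, -, rfl⟩ := List.mem_map.1 hχ
      by_cases hk : k ∈ p.1
      · simpa [lit, hk] using (ψ k).2
      · simpa [lit, hk] using (ψ k).2.not
    have hlit : ∀ (p : Set (Fin m)) (b : Fin n → M), (∀ k, (lit p k).Realize b) ↔ pat b = p := by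
      intro p (b : Fin n → M)
      rw [Set.ext_iff]
      refine forall_congr' fun k => ?_
      by_cases hk : k ∈ p <;> simp [lit, hk, pat, Formula.realize_not]
    have hθr : ∀ b : Fin n → M, θ.Realize b ↔ φ.Realize b := by
      intro b
      simp only [θ, Formula.realize_iSup, Formula.realize_iInf, hlit]
      constructor
      · rintro ⟨⟨p, a, ha, hap⟩, hb⟩
        by_contra hb'
        obtain ⟨k, hk, hk'⟩ := hm a b ha hb'
        have := Set.ext_iff.1 (hap.trans hb.symm) ⟨k, hk⟩
        simp only [pat, Set.mem_ofPred_eq] at this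
        tauto
      · intro hb
        exact ⟨⟨pat b, b, hb, rfl⟩, rfl⟩
    refine hφ θ hθ ?_
    refine Theory.models_formula_iff.2 fun K => ?_
    have hK : M ≅[L] K := by
      rw [elementarilyEquivalent_iff]
      exact fun χ => (realize_iff_of_model_completeTheory M K χ).symm
    refine (forall_realize_iff hK _).1 fun b => ?_
    rw [Formula.realize_iff, hθr]
  choose a a' ha ha' haa using key
  let cast : (ℕ → M) → Ultrapower M := Quotient.mk _
  have los : ∀ (χ : L.Formula (Fin n)) (b : ℕ → Fin n → M),
      χ.Realize (fun i => cast fun m => b m i) ↔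
        ∀ᶠ m in (Filter.hyperfilter ℕ : Filter ℕ), χ.Realize (b m) := fun χ b =>
    Ultraproduct.realize_formula_cast (M := fun _ : ℕ => M)
      (u := Filter.hyperfilter ℕ) χ fun i m => b m i
  have hU := elementarilyEquivalent_ultrapower (L := L) M
  let α : Fin n → Ultrapower M := fun i => cast fun m => a m i
  let α' : Fin n → Ultrapower M := fun i => cast fun m => a' m i
  obtain ⟨S, hS, hSc⟩ := exists_countable_elementarySubstructure (L := L)
    (Set.range α ∪ Set.range α') (Set.to_countable _)
  have hMS : M ≅[L] S := hU.trans S.elementarilyEquivalent.symm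
  let β : Fin n → S := fun i => ⟨α i, hS (Or.inl ⟨i, rfl⟩)⟩
  let β' : Fin n → S := fun i => ⟨α' i, hS (Or.inr ⟨i, rfl⟩)⟩
  have hβ : ∀ χ : L.Formula (Fin n), χ.Realize β ↔ χ.Realize α := fun χ =>
    (S.subtype.map_formula χ β).symm
  have hβ' : ∀ χ : L.Formula (Fin n), χ.Realize β' ↔ χ.Realize α' := fun χ =>
    (S.subtype.map_formula χ β').symm
  have := h S hSc hMS n β β' (by
    intro χ hχ
    obtain ⟨k, hk⟩ := hψ ⟨χ, hχ⟩
    rw [hβ, hβ', los, los]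
    refine Filter.eventually_congr ?_
    filter_upwards [(Filter.hyperfilter_le_cofinite.trans Nat.cofinite_eq_atTop.le)
      (Filter.eventually_gt_atTop k)] with m hm
    have := haa m k hm
    rwa [hk] at this) φ ((hβ φ).2 ((los _ _).2 (Filter.Eventually.of_forall ha)))
  rw [hβ', los] at this
  obtain ⟨m, hm⟩ := this.exists
  exact ha' m hm

end ModelTheory

end NIC

/-! ### Back-and-forth between finite partial isomorphisms. -/

namespace NIC

open FirstOrder FirstOrder.Language

section BackAndForth

variable {L : FirstOrder.Language.{u, v}} {N : Type w} [L.Structure N]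

/-- A relation on `N` is a partial isomorphism if it is the graph of a partial injection and
preserves the relations of the language. -/
def IsPartialIso (L : FirstOrder.Language.{u, v}) {N : Type w} [L.Structure N]
    (p : Set (N × N)) : Prop :=
  (∀ x ∈ p, ∀ y ∈ p, x.1 = y.1 ↔ x.2 = y.2) ∧
    ∀ (n : ℕ) (R : L.Relations n) (x : Fin n → N × N), (∀ i, x i ∈ p) →
      (Structure.RelMap R (fun i => (x i).1) ↔ Structure.RelMap R fun i => (x i).2)

theorem IsPartialIso.swap {p : Set (N × N)} (h : IsPartialIso L p) :
    IsPartialIso L (Prod.swap ⁻¹' p) :=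
  ⟨fun _ hx _ hy => (h.1 _ hx _ hy).symm, fun n R x hx =>
    (h.2 n R (fun i => (x i).swap) hx).symm⟩

theorem exists_eq_var [L.IsRelational] {α : Type*} (t : L.Term α) : ∃ i, t = Term.var i := by
  cases t with
  | var i => exact ⟨i, rfl⟩
  | func f _ => exact isEmptyElim f

theorem IsPartialIso.realize_iff [L.IsRelational] {p : Set (N × N)} (h : IsPartialIso L p)
    {α : Type*} {n : ℕ} {φ : L.BoundedFormula α n} (hφ : BoundedFormula.IsQF φ)
    (a : α → N × N) (ha : ∀ i, a i ∈ p) (b : Fin n → N × N) (hb : ∀ i, b i ∈ p) :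
    φ.Realize (fun i => (a i).1) (fun i => (b i).1) ↔
      φ.Realize (fun i => (a i).2) fun i => (b i).2 := by
  have hab : ∀ i, Sum.elim a b i ∈ p := by
    rintro (i | i)
    · exact ha i
    · exact hb i
  have e1 : (Sum.elim (fun i => (a i).1) fun i => (b i).1) = fun i => (Sum.elim a b i).1 := by
    ext (i | i) <;> rfl
  have e2 : (Sum.elim (fun i => (a i).2) fun i => (b i).2) = fun i => (Sum.elim a b i).2 := by
    ext (i | i) <;> rfl
  induction hφ with
  | falsum => rfl
  | of_isAtomic hφ =>
    cases hφ with
    | equal t₁ t₂ =>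
      obtain ⟨i, rfl⟩ := exists_eq_var t₁
      obtain ⟨j, rfl⟩ := exists_eq_var t₂
      simp only [BoundedFormula.realize_bdEqual, Term.realize_var, e1, e2]
      exact h.1 _ (hab i) _ (hab j)
    | rel R ts =>
      choose j hj using fun i => exists_eq_var (ts i)
      obtain rfl := funext hj
      simp only [BoundedFormula.realize_rel, Term.realize_var, e1, e2]
      exact h.2 _ R (fun i => Sum.elim a b (j i)) fun i => hab _
  | imp _ _ h1 h2 =>
    rw [BoundedFormula.realize_imp, BoundedFormula.realize_imp]
    exact imp_congr h1 h2

theorem IsPartialIso.realize_formula_iff [L.IsRelational] {p : Set (N × N)}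
    (h : IsPartialIso L p) {α : Type*} {φ : L.Formula α} (hφ : BoundedFormula.IsQF φ)
    (a : α → N × N) (ha : ∀ i, a i ∈ p) :
    φ.Realize (fun i => (a i).1) ↔ φ.Realize fun i => (a i).2 := by
  have H := h.realize_iff hφ a ha Fin.elim0 fun i => i.elim0
  rwa [Subsingleton.elim (fun i : Fin 0 => (Fin.elim0 i : N × N).1) default,
    Subsingleton.elim (fun i : Fin 0 => (Fin.elim0 i : N × N).2) default] at H

variable {T : L.Theory}

/-- Quantifier elimination turns the partial isomorphism into an equality of complete types, so the
extension property applies; the atomic formulas of the extended tuples give back a partial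
isomorphism. -/
theorem IsPartialIso.exists_insert [L.IsRelational] [N ⊨ T] [Nonempty N]
    (hqe : EliminatesQuantifiers T)
    (hN : ExtensionProperty L N) {p : Set (N × N)} (hp : p.Finite) (h : IsPartialIso L p)
    {c : N} (hc : ∀ d, (c, d) ∉ p) (E : Finset N) :
    ∃ d ∉ E, IsPartialIso L (insert (c, d) p) := by
  have := hp.to_subtype
  obtain ⟨n, ⟨e⟩⟩ := Finite.exists_equiv_fin p
  obtain ⟨d, hd, H⟩ := hN n (fun i => (e.symm i).1.1) (fun i => (e.symm i).1.2) c E (by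
      intro φ
      obtain ⟨ψ, hψ, hφ⟩ := hqe n φ
      rw [hφ.realize_iff, hφ.realize_iff]
      exact h.realize_formula_iff hψ (fun i => (e.symm i).1) fun i => (e.symm i).2) (by
      rintro ⟨i, rfl⟩
      exact hc _ (e.symm i).2)
  refine ⟨d, hd, ?_⟩
  let x : Fin n ⊕ Unit → N × N := Sum.elim (fun i => (e.symm i).1) fun _ => (c, d)
  have hx1 : (Sum.elim (fun i => (e.symm i).1.1) fun _ => c) = fun i => (x i).1 := by
    ext (i | i) <;> rfl
  have hx2 : (Sum.elim (fun i => (e.symm i).1.2) fun _ => d) = fun i => (x i).2 := by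
    ext (i | i) <;> rfl
  rw [hx1, hx2] at H
  have hx : ∀ y ∈ insert (c, d) p, ∃ j, y = x j := by
    rintro y (rfl | hy)
    · exact ⟨Sum.inr (), rfl⟩
    · exact ⟨Sum.inl (e ⟨y, hy⟩), by simp [x]⟩
  constructor
  · intro y hy z hz
    obtain ⟨i, rfl⟩ := hx y hy
    obtain ⟨j, rfl⟩ := hx z hz
    simpa [Formula.realize_equal] using
      H ((Term.var i : L.Term (Fin n ⊕ Unit)).equal (Term.var j))
  · intro m R y hy
    choose j hj using fun i => hx (y i) (hy i)
    obtain rfl := funext hj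
    simpa [Formula.realize_rel] using H (R.formula fun i => Term.var (j i))

/-- The forth step of back-and-forth. -/
theorem IsPartialIso.exists_extend [L.IsRelational] [N ⊨ T] [Nonempty N]
    (hqe : EliminatesQuantifiers T)
    (hN : ExtensionProperty L N) {p : Set (N × N)} (hp : p.Finite) (h : IsPartialIso L p)
    (c : N) : ∃ q : Set (N × N), q.Finite ∧ IsPartialIso L q ∧ p ⊆ q ∧ ∃ d, (c, d) ∈ q := by
  by_cases hc : ∃ d, (c, d) ∈ p
  · exact ⟨p, hp, h, subset_rfl, hc⟩
  · obtain ⟨d, -, hd⟩ := h.exists_insert hqe hN hp (not_exists.1 hc) ∅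
    exact ⟨_, hp.insert _, hd, Set.subset_insert _ _, d, Set.mem_insert _ _⟩

/-- The finite partial isomorphisms with a given point in the domain, or in the range, are cofinal
under inclusion. An ideal that meets these countably many cofinal sets has as its union the graph of
an automorphism. -/
theorem IsPartialIso.exists_equiv [L.IsRelational] [N ⊨ T] [Nonempty N] [Countable N]
    (hqe : EliminatesQuantifiers T)
    (hN : ExtensionProperty L N) {p : Set (N × N)} (hp : p.Finite) (h : IsPartialIso L p) :
    ∃ g : N ≃[L] N, ∀ x ∈ p, g x.1 = x.2 := by
  let P := {p : Set (N × N) // p.Finite ∧ IsPartialIso L p}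
  have := Encodable.ofCountable (N ⊕ N)
  let 𝒟 : N ⊕ N → Order.Cofinal P := Sum.elim
    (fun c => ⟨{q | ∃ d, (c, d) ∈ q.1}, fun q => by
      obtain ⟨r, hr, hr', hqr, hc⟩ := q.2.2.exists_extend hqe hN q.2.1 c
      exact ⟨⟨r, hr, hr'⟩, hc, hqr⟩⟩)
    (fun c => ⟨{q | ∃ d, (d, c) ∈ q.1}, fun q => by
      obtain ⟨r, hr, hr', hqr, d, hd⟩ := q.2.2.swap.exists_extend hqe hN
        (q.2.1.preimage Prod.swap_injective.injOn) c
      exact ⟨⟨Prod.swap ⁻¹' r, hr.preimage Prod.swap_injective.injOn, hr'.swap⟩, ⟨d, hd⟩,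
        fun x hx => hqr hx⟩⟩)
  let I : Order.Ideal P := Order.idealOfCofinals ⟨p, hp, h⟩ 𝒟
  have hpI : ⟨p, hp, h⟩ ∈ I := Order.mem_idealOfCofinals _ _
  let r : Set (N × N) := {x | ∃ q ∈ I, x ∈ q.1}
  have hfin : ∀ s : Set (N × N), s.Finite → s ⊆ r → ∃ q ∈ I, s ⊆ q.1 := by
    intro s hs hsr
    induction s, hs using Set.Finite.induction_on with
    | empty => exact ⟨_, hpI, Set.empty_subset _⟩
    | insert _ _ ih =>
      obtain ⟨q, hq, hsq⟩ := ih ((Set.subset_insert _ _).trans hsr)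
      obtain ⟨q', hq', hxq⟩ := hsr (Set.mem_insert _ _)
      obtain ⟨q'', hq'', h1, h2⟩ := I.directed q hq q' hq'
      exact ⟨q'', hq'', Set.insert_subset (h2 hxq) (hsq.trans h1)⟩
  have hr : IsPartialIso L r := by
    constructor
    · intro x hx y hy
      obtain ⟨q, -, hq⟩ := hfin {x, y} (Set.toFinite _) (by
        rintro z (rfl | rfl)
        exacts [hx, hy])
      exact q.2.2.1 x (hq (by simp)) y (hq (by simp))
    · intro n R x hx
      obtain ⟨q, -, hq⟩ := hfin (Set.range x) (Set.finite_range x) (by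
        rintro _ ⟨i, rfl⟩
        exact hx i)
      exact q.2.2.2 n R x fun i => hq ⟨i, rfl⟩
  have hdom : ∀ c, ∃ d, (c, d) ∈ r := by
    intro c
    obtain ⟨q, ⟨d, hd⟩, hq⟩ := Order.cofinal_meets_idealOfCofinals ⟨p, hp, h⟩ 𝒟 (Sum.inl c)
    exact ⟨d, q, hq, hd⟩
  have hcod : ∀ c, ∃ d, (d, c) ∈ r := by
    intro c
    obtain ⟨q, ⟨d, hd⟩, hq⟩ := Order.cofinal_meets_idealOfCofinals ⟨p, hp, h⟩ 𝒟 (Sum.inr c)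
    exact ⟨d, q, hq, hd⟩
  choose g hg using hdom
  choose g' hg' using hcod
  refine ⟨⟨⟨g, g', fun x => ?_, fun x => ?_⟩, fun f => isEmptyElim f, fun R x => ?_⟩, ?_⟩
  · exact (hr.1 _ (hg' (g x)) _ (hg x)).2 rfl
  · exact (hr.1 _ (hg (g' x)) _ (hg' x)).1 rfl
  · exact (hr.2 _ R (fun i => (x i, g (x i))) fun i => hg _).symm
  · intro x hx
    exact (hr.1 _ (hg x.1) _ ⟨_, hpI, hx⟩).1 rfl

end BackAndForth

end NIC

/-! ### Abstract trees in the language of the construction -/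

namespace TreePlan

open FirstOrder FirstOrder.Language

variable {Γ : TreePlan} {S : Type w}

/-! #### Nodes -/

theorem isNode_concat_iff {l : List (ℕ × Option S)} {k : ℕ} {t : Option S} :
    Γ.IsNode S (l ++ [(k, t)]) ↔ Γ.IsNode S l ∧ l.map Prod.fst ++ [k] ∈ Γ.nodes ∧
      (t ≠ none ↔ l.map Prod.fst ++ [k] ∈ Γ.infNodes) := by
  constructor
  · intro h
    refine ⟨h.of_prefix (List.prefix_append _ _), by simpa using h.1, ?_⟩
    have := h.2 l.length (by simp)
    simpa [List.take_of_length_le] using this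
  · rintro ⟨h1, h2, h3⟩
    refine ⟨by simpa using h2, fun m hm => ?_⟩
    rcases Nat.lt_or_ge m l.length with h | h
    · rw [List.getElem_append_left h, List.map_append,
        List.take_append_of_le_length (by simp; omega)]
      exact h1.2 m h
    · have : m = l.length := by simp at hm; omega
      subst this
      simpa [List.take_of_length_le] using h3

namespace Node

@[ext] theorem ext {a b : Γ.Node S} (h : a.1 = b.1) : a = b := Subtype.ext h

theorem proj_concat {a a' : Γ.Node S} {k : ℕ} {t : Option S} (h : a'.1 = a.1 ++ [(k, t)]) :
    a'.proj = a.proj ++ [k] := by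
  simp [proj, h]

theorem pred_concat {a a' : Γ.Node S} {k : ℕ} {t : Option S} (h : a'.1 = a.1 ++ [(k, t)]) :
    a'.pred = a := by
  ext1
  simp [pred, h]

theorem proj_pred (a : Γ.Node S) : a.pred.proj = a.proj.dropLast := by
  simp [proj, pred, List.map_dropLast]

theorem exists_eq_concat {a : Γ.Node S} {σ : List ℕ} {k : ℕ} (h : a.proj = σ ++ [k]) :
    ∃ t, a.1 = a.pred.1 ++ [(k, t)] := by
  rcases List.eq_nil_or_concat a.1 with h' | ⟨l, ⟨k', t⟩, h'⟩
  · simp [proj, h'] at h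
  · have : k' = k := by
      simp [proj, h'] at h
      exact h.2
    subst this
    exact ⟨t, by simp [pred, h']⟩

theorem exists_eq_concat_some {a : Γ.Node S} {σ : List ℕ} {k : ℕ} (h : a.proj = σ ++ [k])
    (hinf : a.proj ∈ Γ.infNodes) : ∃ s, a.1 = a.pred.1 ++ [(k, some s)] := by
  obtain ⟨t, ht⟩ := exists_eq_concat h
  have h2 := a.2
  rw [ht, isNode_concat_iff] at h2
  rw [proj_concat ht] at hinf
  obtain ⟨s, rfl⟩ := Option.ne_none_iff_exists'.1 (h2.2.2.2 hinf)
  exact ⟨s, ht⟩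

theorem eq_concat_none {a : Γ.Node S} {σ : List ℕ} {k : ℕ} (h : a.proj = σ ++ [k])
    (hinf : a.proj ∉ Γ.infNodes) : a.1 = a.pred.1 ++ [(k, none)] := by
  obtain ⟨t, ht⟩ := exists_eq_concat h
  have h2 := a.2
  rw [ht, isNode_concat_iff] at h2
  rw [proj_concat ht] at hinf
  obtain rfl := not_not.1 (mt h2.2.2.1 hinf)
  exact ht

theorem eq_root_of_proj {a : Γ.Node S} (h : a.proj = []) : a = root := by
  ext1
  simpa [proj, root] using h

theorem pred_iterate_val (a : Γ.Node S) (m : ℕ) : (pred^[m] a).1 = a.1.take (a.1.length - m) := by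
  induction m with
  | zero => simp
  | succ m ih =>
    rw [Function.iterate_succ_apply']
    simp only [pred, ih, List.dropLast_eq_take, List.take_take, List.length_take]
    congr 1
    omega

theorem le_iff_exists_pred {a b : Γ.Node S} : a ≤ b ↔ ∃ m ≤ b.1.length, a = pred^[m] b := by
  constructor
  · intro h
    have h' : a.1 <+: b.1 := h
    refine ⟨b.1.length - a.1.length, by omega, ?_⟩
    ext1
    rw [pred_iterate_val, Nat.sub_sub_self h'.length_le]
    exact List.prefix_iff_eq_take.1 h'
  · rintro ⟨m, -, rfl⟩
    change (pred^[m] b).1 <+: b.1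
    rw [pred_iterate_val]
    exact List.take_prefix _ _

end Node

theorem _root_.NIC.prefix_commonPrefix {α : Type w} {r : List α} :
    ∀ {l m : List α}, r <+: NIC.commonPrefix l m ↔ r <+: l ∧ r <+: m := by
  induction r with
  | nil => simp
  | cons c r ih =>
    intro l m
    rcases l with _ | ⟨a, l⟩
    · simp [NIC.commonPrefix]
    rcases m with _ | ⟨b, m⟩
    · simp [NIC.commonPrefix]
    by_cases h : a = b
    · subst h
      simp only [NIC.commonPrefix, if_true, List.cons_prefix_cons, ih]
      tauto
    · simp only [NIC.commonPrefix, h, if_false, List.cons_prefix_cons, List.prefix_nil]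
      constructor
      · simp
      · rintro ⟨⟨rfl, -⟩, h', -⟩
        exact absurd h' h

/-! #### Structures for the language `L*` -/

variable (L : Γ.infNodes → FirstOrder.Language.{u, v})

/-- The symbol `ε` of `L*`. -/
abbrev rootSymb : (starLang Γ L).Functions 0 := Sum.inl TreeFunction.root

/-- The symbol `pred` of `L*`. -/
abbrev predSymb : (starLang Γ L).Functions 1 := Sum.inl TreeFunction.pred

/-- The symbol `⊓` of `L*`. -/
abbrev meetSymb : (starLang Γ L).Functions 2 := Sum.inl TreeFunction.meet

/-- The symbol `≤` of `L*`. -/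
abbrev leSymb : (starLang Γ L).Relations 2 := Sum.inl TreeRelation.le

/-- The symbol `P_σ` of `L*`. -/
abbrev projSymb (σ : Γ.nodes) : (starLang Γ L).Relations 1 := Sum.inl (TreeRelation.P σ)

/-- The symbol of `L*` that comes from a symbol of `L_σ`. -/
abbrev hatSymb (σ : Γ.infNodes) {n : ℕ} (R : (L σ).Relations n) :
    (starLang Γ L).Relations (n + 1) := Sum.inr (HatRelation.hat σ R)

section Structures

variable {K : Type*} [(starLang Γ L).Structure K]

/-- The root of an `L*`-structure. -/
def kroot (K : Type*) [(starLang Γ L).Structure K] : K :=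
  Structure.funMap (rootSymb L) ![]

/-- The predecessor in an `L*`-structure. -/
def kpred (x : K) : K :=
  Structure.funMap (predSymb L) ![x]

/-- The meet in an `L*`-structure. -/
def kmeet (x y : K) : K :=
  Structure.funMap (meetSymb L) ![x, y]

/-- The order relation of an `L*`-structure. -/
def kle (x y : K) : Prop :=
  Structure.RelMap (leSymb L) ![x, y]

/-- The predicate `P_σ` of an `L*`-structure. -/
def kproj (σ : List ℕ) (x : K) : Prop :=
  ∃ h : σ ∈ Γ.nodes,
    Structure.RelMap (projSymb L ⟨σ, h⟩) ![x]

/-- The new relations of an `L*`-structure. -/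
def khat (σ : Γ.infNodes) {n : ℕ} (R : (L σ).Relations n) (x : Fin (n + 1) → K) : Prop :=
  Structure.RelMap (hatSymb L σ R) x

variable (Γ) in
/-- The height of a tree plan. -/
def height : ℕ := Γ.nodes.sup List.length

/-- The basic first-order properties of `Γ(S)` with the new relations. -/
structure IsTree (K : Type*) [(starLang Γ L).Structure K] : Prop where
  exists_proj : ∀ x : K, ∃ σ : Γ.nodes, kproj L σ.1 x
  proj_unique : ∀ {σ τ : List ℕ} {x : K}, kproj L σ x → kproj L τ x → σ = τ
  proj_nil : ∀ {x : K}, kproj L [] x ↔ x = kroot L K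
  pred_root : kpred L (kroot L K) = kroot L K
  proj_pred : ∀ {σ : List ℕ} {k : ℕ} {x : K}, kproj L (σ ++ [k]) x → kproj L σ (kpred L x)
  le_iff : ∀ {x y : K}, kle L x y ↔ ∃ m : Fin (Γ.height + 1), x = (kpred L)^[m] y
  le_antisymm : ∀ {x y : K}, kle L x y → kle L y x → x = y
  le_meet : ∀ {x y z : K}, kle L z (kmeet L x y) ↔ kle L z x ∧ kle L z y
  exists_star : ∀ {σ : List ℕ} {k : ℕ} {y : K}, σ ++ [k] ∈ Γ.nodes → σ ++ [k] ∉ Γ.infNodes →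
    kproj L σ y → ∃ x, kpred L x = y ∧ kproj L (σ ++ [k]) x
  star_unique : ∀ {σ : List ℕ} {x x' : K}, σ ∉ Γ.infNodes →
    kproj L σ x → kproj L σ x' → kpred L x = kpred L x' → x = x'
  of_hat : ∀ {σ : Γ.infNodes} {n : ℕ} {R : (L σ).Relations n} {x : Fin (n + 1) → K},
    khat L σ R x → kproj L σ.1.dropLast (x 0) ∧
      ∀ i : Fin n, kpred L (x i.succ) = x 0 ∧ kproj L σ.1 (x i.succ)

variable {L}

theorem IsTree.le_refl (hK : IsTree L K) (x : K) : kle L x x :=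
  hK.le_iff.2 ⟨0, rfl⟩

/-- Under the tree axioms the root, the order and the meet are determined by `pred` and the
predicates `P_σ`, so only these and the new relations need to be checked. -/
theorem IsTree.exists_equiv {K' : Type*} [(starLang Γ L).Structure K'] (hK : IsTree L K)
    (hK' : IsTree L K') (e : K ≃ K') (hpred : ∀ x, e (kpred L x) = kpred L (e x))
    (hproj : ∀ σ x, kproj L σ x ↔ kproj L σ (e x))
    (hhat : ∀ (σ : Γ.infNodes) {n : ℕ} (R : (L σ).Relations n) (x : Fin (n + 1) → K),
      khat L σ R x ↔ khat L σ R (e ∘ x)) :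
    ∃ g : K ≃[starLang Γ L] K', ∀ x, g x = e x := by
  have hit : ∀ (m : ℕ) x, e ((kpred L)^[m] x) = (kpred L)^[m] (e x) := by
    intro m
    induction m with
    | zero => exact fun _ => rfl
    | succ m ih =>
      intro x
      rw [Function.iterate_succ_apply', Function.iterate_succ_apply', hpred, ih]
  have hle : ∀ x y, kle L x y ↔ kle L (e x) (e y) := by
    intro x y
    rw [hK.le_iff, hK'.le_iff]
    refine exists_congr fun m => ?_
    rw [← hit, e.injective.eq_iff]
  have hroot : e (kroot L K) = kroot L K' := hK'.proj_nil.1 ((hproj _ _).1 (hK.proj_nil.2 rfl))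
  have hmeet : ∀ a b, e (kmeet L a b) = kmeet L (e a) (e b) := by
    intro a b
    apply hK'.le_antisymm
    · have := hK.le_meet.1 (hK.le_refl (kmeet L a b))
      exact hK'.le_meet.2 ⟨(hle _ _).1 this.1, (hle _ _).1 this.2⟩
    · have := hK'.le_meet.1 (hK'.le_refl (kmeet L (e a) (e b)))
      obtain ⟨z, hz⟩ := e.surjective (kmeet L (e a) (e b))
      rw [← hz] at this ⊢
      exact (hle _ _).1 (hK.le_meet.2 ⟨(hle _ _).2 this.1, (hle _ _).2 this.2⟩)
  have h0 : e ∘ ![] = (![] : Fin 0 → K') := Subsingleton.elim _ _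
  have h1 : ∀ a, e ∘ ![a] = ![e a] := fun a => by
    ext i
    fin_cases i
    rfl
  have h2 : ∀ a b, e ∘ ![a, b] = ![e a, e b] := fun a b => by
    ext i
    fin_cases i <;> rfl
  refine ⟨⟨e, ?_, ?_⟩, fun _ => rfl⟩
  · intro n F x
    rcases F with F | F
    · cases F with
      | root =>
        obtain rfl : x = ![] := Subsingleton.elim _ _
        exact hroot.trans (congrArg (Structure.funMap (rootSymb L)) h0.symm)
      | pred =>
        obtain ⟨a, rfl⟩ : ∃ a, x = ![a] := ⟨x 0, by ext i; fin_cases i; rfl⟩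
        exact (hpred a).trans (congrArg (Structure.funMap (predSymb L)) (h1 a).symm)
      | meet =>
        obtain ⟨a, b, rfl⟩ : ∃ a b, x = ![a, b] := ⟨x 0, x 1, by ext i; fin_cases i <;> rfl⟩
        exact (hmeet a b).trans (congrArg (Structure.funMap (meetSymb L)) (h2 a b).symm)
    · exact F.elim
  · intro n R x
    rcases R with R | R
    · cases R with
      | le =>
        obtain ⟨a, b, rfl⟩ : ∃ a b, x = ![a, b] := ⟨x 0, x 1, by ext i; fin_cases i <;> rfl⟩
        exact (congrArg (Structure.RelMap (leSymb L)) (h2 a b)).to_iff.trans (hle a b).symm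
      | P σ =>
        obtain ⟨a, rfl⟩ : ∃ a, x = ![a] := ⟨x 0, by ext i; fin_cases i; rfl⟩
        have := hproj σ.1 a
        simp only [kproj, σ.2, exists_true_left] at this
        exact (congrArg (Structure.RelMap (projSymb L σ)) (h1 a)).to_iff.trans this.symm
    · cases R with
      | hat σ R => exact (hhat σ R x).symm

end Structures

end TreePlan

/-! ### The glued structure satisfies the tree axioms. -/

namespace TreePlan

open FirstOrder FirstOrder.Language

variable {Γ : TreePlan} {S : Type w} (L : Γ.infNodes → FirstOrder.Language.{u, v})

section Glued

variable (N : Γ.infNodes → Type w) [∀ σ, (L σ).Structure (N σ)] (f : ∀ σ, S ≃ N σ)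

/-- The description of the glued structure on `Γ(S)`. -/
structure IsGlued [(starLang Γ L).Structure (Γ.Node S)] : Prop where
  kroot_eq : kroot L (Γ.Node S) = Node.root
  kpred_eq : ∀ x : Γ.Node S, kpred L x = x.pred
  kmeet_eq : ∀ x y : Γ.Node S, kmeet L x y = x.meet y
  kle_iff : ∀ x y : Γ.Node S, kle L x y ↔ x ≤ y
  kproj_iff : ∀ (σ : List ℕ) (x : Γ.Node S), kproj L σ x ↔ x.proj = σ
  khat_iff : ∀ (σ : Γ.infNodes) (n : ℕ) (R : (L σ).Relations n) (x : Fin (n + 1) → Γ.Node S),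
    khat L σ R x ↔ ∃ (k : ℕ) (s : Fin n → S), σ.1 = (x 0).proj ++ [k] ∧
      (∀ i, (x i.succ).1 = (x 0).1 ++ [(k, some (s i))]) ∧
      Structure.RelMap R fun i => f σ (s i)

theorem isGlued_gluedStructure :
    @IsGlued Γ S L N _ f (gluedStructure L N f) := by
  let := gluedStructure L N f
  refine ⟨rfl, fun _ => rfl, fun _ _ => rfl, fun _ _ => Iff.rfl, fun σ x => ?_,
    fun _ _ _ _ => Iff.rfl⟩
  constructor
  · rintro ⟨_, h⟩
    exact h
  · rintro rfl
    exact ⟨x.proj_mem, rfl⟩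

variable {L N f} [(starLang Γ L).Structure (Γ.Node S)]

theorem IsGlued.kpred_iterate (hM : IsGlued L N f) (m : ℕ) (x : Γ.Node S) :
    (kpred L)^[m] x = Node.pred^[m] x := by
  have : kpred L = (Node.pred : Γ.Node S → Γ.Node S) := funext hM.kpred_eq
  rw [this]

theorem length_le_height (a : Γ.Node S) : a.1.length ≤ Γ.height := by
  have := Finset.le_sup (f := List.length) a.proj_mem
  rwa [Node.proj, List.length_map] at this

theorem IsGlued.isTree (hM : IsGlued L N f) : IsTree L (Γ.Node S) where
  exists_proj x := ⟨⟨x.proj, x.proj_mem⟩, (hM.kproj_iff _ _).2 rfl⟩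
  proj_unique h1 h2 := by
    rw [hM.kproj_iff] at h1 h2
    exact h1.symm.trans h2
  proj_nil {x} := by
    rw [hM.kproj_iff, hM.kroot_eq]
    exact ⟨Node.eq_root_of_proj, by rintro rfl; rfl⟩
  pred_root := by
    rw [hM.kpred_eq, hM.kroot_eq]
    rfl
  proj_pred h := by
    rw [hM.kproj_iff] at h
    rw [hM.kproj_iff, hM.kpred_eq, Node.proj_pred, h, List.dropLast_concat]
  le_iff {x y} := by
    rw [hM.kle_iff, Node.le_iff_exists_pred]
    constructor
    · rintro ⟨m, hm, rfl⟩
      exact ⟨⟨m, by have := length_le_height y; omega⟩, (hM.kpred_iterate _ _).symm⟩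
    · rintro ⟨m, rfl⟩
      rw [hM.kpred_iterate]
      by_cases hm : m.1 ≤ y.1.length
      · exact ⟨m, hm, rfl⟩
      -- Iterates beyond the length of `y` remain at the root.
      · refine ⟨y.1.length, le_rfl, ?_⟩
        ext1
        rw [Node.pred_iterate_val, Node.pred_iterate_val, Nat.sub_self,
          Nat.sub_eq_zero_of_le (not_le.1 hm).le]
  le_antisymm {x y} h1 h2 := by
    rw [hM.kle_iff] at h1 h2
    have h1' : x.1 <+: y.1 := h1
    have h2' : y.1 <+: x.1 := h2
    ext1
    exact h1'.eq_of_length (le_antisymm h1'.length_le h2'.length_le)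
  le_meet {x y z} := by
    rw [hM.kle_iff, hM.kle_iff, hM.kle_iff, hM.kmeet_eq]
    exact NIC.prefix_commonPrefix
  exists_star {σ k y} hσ hσ' h := by
    rw [hM.kproj_iff] at h
    subst h
    have hn : Γ.IsNode S (y.1 ++ [(k, none)]) :=
      isNode_concat_iff.2 ⟨y.2, hσ, by simpa using! hσ'⟩
    let b : Γ.Node S := ⟨_, hn⟩
    refine ⟨b, ?_, ?_⟩
    · rw [hM.kpred_eq]
      exact Node.pred_concat rfl
    · rw [hM.kproj_iff]
      exact Node.proj_concat (a := y) rfl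
  star_unique {σ x x'} hσ h1 h2 h := by
    rw [hM.kproj_iff] at h1 h2
    rw [hM.kpred_eq, hM.kpred_eq] at h
    rcases List.eq_nil_or_concat σ with rfl | ⟨τ, k, rfl⟩
    · rw [Node.eq_root_of_proj h1, Node.eq_root_of_proj h2]
    · rw [List.concat_eq_append] at *
      ext1
      rw [Node.eq_concat_none h1 (h1 ▸ hσ), Node.eq_concat_none h2 (h2 ▸ hσ), h]
  of_hat {σ n R x} h := by
    obtain ⟨k, s, hσ, hx, -⟩ := (hM.khat_iff _ _ _ _).1 h
    simp only [hM.kproj_iff, hM.kpred_eq]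
    refine ⟨by rw [hσ, List.dropLast_concat], fun i => ⟨Node.pred_concat (hx i), ?_⟩⟩
    rw [Node.proj_concat (hx i), hσ]

end Glued

/-! #### Isomorphisms from the glued structure -/

section Embed

variable {K : Type*} [(starLang Γ L).Structure K]
  (h : List (ℕ × Option S) → K → Γ.infNodes → S → K)

open Classical in
/-- The image of the child of `l` with last entry `p` if `y` is the image of `l`. -/
noncomputable def child (l : List (ℕ × Option S)) (y : K) (p : ℕ × Option S) : K :=
  match p.2 with
  | some s => if hσ : l.map Prod.fst ++ [p.1] ∈ Γ.infNodes then h l y ⟨_, hσ⟩ s else y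
  | none => if hx : ∃ x, kpred L x = y ∧ kproj L (l.map Prod.fst ++ [p.1]) x then hx.choose else y

/-- The map `l ↦ embed l.reverse`, by structural recursion. -/
noncomputable def embedRev : List (ℕ × Option S) → K
  | [] => kroot L K
  | p :: r => child L h r.reverse (embedRev r) p

/-- The map from `Γ(S)` to `K` which is given by the maps `h` on the components. -/
noncomputable def embed (l : List (ℕ × Option S)) : K := embedRev L h l.reverse

theorem embed_concat (l : List (ℕ × Option S)) (p : ℕ × Option S) :
    embed L h (l ++ [p]) = child L h l (embed L h l) p := by
  simp [embed, embedRev]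

variable {L h}

theorem child_some (a : Γ.Node S) (y : K) {k : ℕ} (s : S) {σ : Γ.infNodes}
    (hσ : σ.1 = a.proj ++ [k]) : child L h a.1 y (k, some s) = h a.1 y σ s := by
  obtain ⟨σ, hσ'⟩ := σ
  simp only at hσ
  subst hσ
  exact dif_pos (c := a.proj ++ [k] ∈ Γ.infNodes) hσ'

theorem child_none (hK : IsTree L K) {a : Γ.Node S} {y : K} {k : ℕ}
    (hn : Γ.IsNode S (a.1 ++ [(k, none)])) (hy : kproj L a.proj y) :
    kpred L (child L h a.1 y (k, none)) = y ∧
      kproj L (a.proj ++ [k]) (child L h a.1 y (k, none)) := by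
  obtain ⟨-, h1, h2⟩ := isNode_concat_iff.1 hn
  have hx : ∃ x, kpred L x = y ∧ kproj L (a.proj ++ [k]) x :=
    hK.exists_star h1 (by simpa using! h2) hy
  have : child L h a.1 y (k, none) = hx.choose :=
    dif_pos (c := ∃ x, kpred L x = y ∧ kproj L (a.proj ++ [k]) x) hx
  rw [this]
  exact hx.choose_spec

/-- The maps `h` are bijections onto the components. -/
structure ComponentMaps (L : Γ.infNodes → FirstOrder.Language.{u, v})
    [(starLang Γ L).Structure K] (h : List (ℕ × Option S) → K → Γ.infNodes → S → K) : Prop where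
  injective : ∀ (a : Γ.Node S) (y : K) (σ : Γ.infNodes) (k : ℕ), σ.1 = a.proj ++ [k] →
    kproj L a.proj y → Function.Injective (h a.1 y σ)
  mem : ∀ (a : Γ.Node S) (y : K) (σ : Γ.infNodes) (k : ℕ), σ.1 = a.proj ++ [k] →
    kproj L a.proj y → ∀ s, kpred L (h a.1 y σ s) = y ∧ kproj L σ.1 (h a.1 y σ s)
  surjective : ∀ (a : Γ.Node S) (y : K) (σ : Γ.infNodes) (k : ℕ), σ.1 = a.proj ++ [k] →
    kproj L a.proj y → ∀ x, kpred L x = y → kproj L σ.1 x → ∃ s, h a.1 y σ s = x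

theorem child_spec (hK : IsTree L K) (hh : ComponentMaps L h) {a : Γ.Node S} {y : K}
    {p : ℕ × Option S} (hn : Γ.IsNode S (a.1 ++ [p])) (hy : kproj L a.proj y) :
    kpred L (child L h a.1 y p) = y ∧ kproj L (a.proj ++ [p.1]) (child L h a.1 y p) := by
  obtain ⟨k, _ | s⟩ := p
  · exact child_none hK hn hy
  · obtain ⟨-, h1, h2⟩ := isNode_concat_iff.1 hn
    have hσ : a.proj ++ [k] ∈ Γ.infNodes := h2.1 (by simp)
    rw [child_some a y s (σ := ⟨_, hσ⟩) rfl]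
    exact hh.mem a y ⟨_, hσ⟩ k rfl hy s

theorem kproj_embed (hK : IsTree L K) (hh : ComponentMaps L h) :
    ∀ (l : List (ℕ × Option S)), Γ.IsNode S l → kproj L (l.map Prod.fst) (embed L h l) := by
  intro l
  induction l using List.reverseRecOn with
  | nil => exact fun _ => hK.proj_nil.2 rfl
  | append_singleton l p ih =>
    intro hn
    have hl : Γ.IsNode S l := hn.of_prefix (List.prefix_append _ _)
    rw [embed_concat, List.map_append]
    exact (child_spec hK hh (a := ⟨l, hl⟩) hn (ih hl)).2

theorem kpred_embed (hK : IsTree L K) (hh : ComponentMaps L h) (l : List (ℕ × Option S))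
    (p : ℕ × Option S) (hn : Γ.IsNode S (l ++ [p])) : kpred L (embed L h (l ++ [p])) = embed L h l := by
  have hl : Γ.IsNode S l := hn.of_prefix (List.prefix_append _ _)
  rw [embed_concat]
  exact (child_spec hK hh (a := ⟨l, hl⟩) hn (kproj_embed hK hh l hl)).1

/-- Induction along the tree: equal images have equal predecessors, hence equal parents, and equal
predicates `P_σ`, hence equal last indices. Within one component the maps `h` are injective. -/
theorem embed_injective (hK : IsTree L K) (hh : ComponentMaps L h) :
    ∀ (l l' : List (ℕ × Option S)), Γ.IsNode S l → Γ.IsNode S l' → embed L h l = embed L h l' →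
      l = l' := by
  intro l
  induction l using List.reverseRecOn with
  | nil =>
    intro l' h1 h2 he
    have := hK.proj_unique (kproj_embed hK hh _ h1) (he ▸ kproj_embed hK hh _ h2)
    simpa using this.symm
  | append_singleton l p ih =>
    intro l' h1 h2 he
    have hp := hK.proj_unique (kproj_embed hK hh _ h1) (he ▸ kproj_embed hK hh _ h2)
    rcases List.eq_nil_or_concat l' with rfl | ⟨l', p', rfl⟩
    · simp at hp
    rw [List.concat_eq_append] at *
    have hl : Γ.IsNode S l := h1.of_prefix (List.prefix_append _ _)
    have hl' : Γ.IsNode S l' := h2.of_prefix (List.prefix_append _ _)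
    have hpred := congrArg (kpred L) he
    rw [kpred_embed hK hh _ _ h1, kpred_embed hK hh _ _ h2] at hpred
    obtain rfl := ih l' hl hl' hpred
    obtain ⟨k, t⟩ := p
    obtain ⟨k', t'⟩ := p'
    obtain rfl : k = k' := by simpa using hp
    -- Whether the last entry is `⋆` depends only on the projection, so the mixed cases are
    -- impossible.
    have e1 := (isNode_concat_iff.1 h1).2.2
    have e2 := (isNode_concat_iff.1 h2).2.2
    rcases t with _ | s <;> rcases t' with _ | s'
    · rfl
    · simp only [ne_eq, not_true_eq_false, false_iff] at e1
      exact absurd (e2.1 (by simp)) e1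
    · simp only [ne_eq, not_true_eq_false, false_iff] at e2
      exact absurd (e1.1 (by simp)) e2
    · have hσ := e1.1 (by simp)
      rw [embed_concat, embed_concat,
        child_some ⟨l, hl⟩ _ _ (σ := ⟨_, hσ⟩) rfl,
        child_some ⟨l, hl⟩ _ _ (σ := ⟨_, hσ⟩) rfl] at he
      rw [hh.injective ⟨l, hl⟩ _ ⟨_, hσ⟩ k rfl (kproj_embed hK hh l hl) he]

theorem embed_surjective (hK : IsTree L K) (hh : ComponentMaps L h) :
    ∀ (σ : List ℕ) (x : K), kproj L σ x → ∃ a : Γ.Node S, embed L h a.1 = x := by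
  intro σ
  induction σ using List.reverseRecOn with
  | nil => exact fun x hx => ⟨Node.root, (hK.proj_nil.1 hx).symm⟩
  | append_singleton σ k ih =>
    intro x hx
    obtain ⟨a, ha⟩ := ih _ (hK.proj_pred hx)
    have hpa := kproj_embed hK hh _ a.2
    rw [ha] at hpa
    obtain rfl := hK.proj_unique hpa (hK.proj_pred hx)
    by_cases hσ : a.proj ++ [k] ∈ Γ.infNodes
    · obtain ⟨s, hs⟩ := hh.surjective a _ ⟨_, hσ⟩ k rfl hpa x rfl hx
      refine ⟨⟨a.1 ++ [(k, some s)], isNode_concat_iff.2 ⟨a.2, hx.1, by simpa using! hσ⟩⟩, ?_⟩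
      rw [embed_concat, ha, child_some a _ _ (σ := ⟨_, hσ⟩) rfl, hs]
    · have hn : Γ.IsNode S (a.1 ++ [(k, none)]) :=
        isNode_concat_iff.2 ⟨a.2, hx.1, by simpa using! hσ⟩
      refine ⟨⟨_, hn⟩, ?_⟩
      rw [embed_concat, ha]
      obtain ⟨h1, h2⟩ := child_none hK hn hpa
      exact hK.star_unique hσ h2 hx h1

variable {N : Γ.infNodes → Type w} [∀ σ, (L σ).Structure (N σ)] {f : ∀ σ, S ≃ N σ}
  [(starLang Γ L).Structure (Γ.Node S)]

/-- Bijections from `S` to the components of `K` that respect the relations of `L σ` determine an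
isomorphism. This is used both for uniqueness of the countable model and for the construction of
automorphisms. -/
theorem IsGlued.exists_equiv (hM : IsGlued L N f) (hK : IsTree L K) (hh : ComponentMaps L h)
    (hrel : ∀ (a : Γ.Node S) (y : K) (σ : Γ.infNodes) (k : ℕ), σ.1 = a.proj ++ [k] →
      kproj L a.proj y → ∀ (n : ℕ) (R : (L σ).Relations n) (s : Fin n → S),
      Structure.RelMap R (fun i => f σ (s i)) ↔
        khat L σ R (Fin.cons y fun i => h a.1 y σ (s i))) :
    ∃ e : Γ.Node S ≃[starLang Γ L] K, ∀ a, e a = embed L h a.1 := by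
  have hinj : Function.Injective fun a : Γ.Node S => embed L h a.1 := fun a b hab =>
    Node.ext (embed_injective hK hh _ _ a.2 b.2 hab)
  have hsurj : Function.Surjective fun a : Γ.Node S => embed L h a.1 := by
    intro x
    obtain ⟨σ, hσ⟩ := hK.exists_proj x
    exact embed_surjective hK hh _ x hσ
  have hproj : ∀ (σ : List ℕ) (a : Γ.Node S), kproj L σ a ↔ kproj L σ (embed L h a.1) := by
    intro σ a
    rw [hM.kproj_iff]
    constructor
    · rintro rfl
      exact kproj_embed hK hh _ a.2
    · exact hK.proj_unique (kproj_embed hK hh _ a.2)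
  have hpred : ∀ a : Γ.Node S, embed L h a.pred.1 = kpred L (embed L h a.1) := by
    intro a
    rcases List.eq_nil_or_concat a.1 with h' | ⟨l, p, h'⟩
    · have : a = Node.root := by ext1; exact h'
      subst this
      exact hK.pred_root.symm
    · rw [List.concat_eq_append] at h'
      have h2 := a.2
      rw [h'] at h2
      rw [h', kpred_embed hK hh _ _ h2, Node.pred]
      simp only [h', List.dropLast_concat]
  refine hM.isTree.exists_equiv hK (Equiv.ofBijective _ ⟨hinj, hsurj⟩) (fun a => ?_) hproj ?_
  · rw [hM.kpred_eq]
    exact hpred a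
  · intro σ n R x
    rw [hM.khat_iff]
    have key : ∀ (k : ℕ) (s : Fin n → S), σ.1 = (x 0).proj ++ [k] →
        (∀ i, (x i.succ).1 = (x 0).1 ++ [(k, some (s i))]) →
        (Structure.RelMap R (fun i => f σ (s i)) ↔
          khat L σ R fun i => embed L h (x i).1) := by
      intro k s hσ hx
      rw [hrel (x 0) (embed L h (x 0).1) σ k hσ (kproj_embed hK hh _ (x 0).2)]
      have : (fun i => embed L h (x i).1) = (Fin.cons (embed L h (x 0).1)
          fun i => h (x 0).1 (embed L h (x 0).1) σ (s i) : Fin (n + 1) → K) := by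
        ext i
        refine Fin.cases rfl (fun i => ?_) i
        rw [hx, embed_concat, child_some (x 0) _ _ hσ]
        rfl
      rw [this]
    constructor
    · rintro ⟨k, s, hσ, hx, hR⟩
      exact (key k s hσ hx).1 hR
    -- In `K` the new relations hold only between a node and its children in one component, by
    -- `of_hat`, so the tuple pulls back to the required form.
    · intro hR
      obtain ⟨h0, hi⟩ := hK.of_hat hR
      have hσ0 : (x 0).proj = σ.1.dropLast := (hM.kproj_iff _ _).1 ((hproj _ _).2 h0)
      have hσne : σ.1 ≠ [] := fun h' => Γ.nil_notMem_infNodes (h' ▸ σ.2)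
      have hσ : σ.1 = (x 0).proj ++ [σ.1.getLast hσne] := by
        rw [hσ0, List.dropLast_append_getLast]
      have hs : ∀ i : Fin n, ∃ s, (x i.succ).1 = (x 0).1 ++ [(σ.1.getLast hσne, some s)] := by
        intro i
        have hp : (x i.succ).pred = x 0 := hinj ((hpred _).trans (hi i).1)
        have hp' : (x i.succ).proj = σ.1 := (hM.kproj_iff _ _).1 ((hproj _ _).2 (hi i).2)
        obtain ⟨s, hs⟩ := Node.exists_eq_concat_some (hp'.trans hσ) (hp' ▸ σ.2)
        exact ⟨s, by rw [hs, hp]⟩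
      choose s hs using hs
      exact ⟨_, s, hσ, hs, (key _ s hσ hs).2 hR⟩

end Embed

end TreePlan

namespace TreePlan

open FirstOrder FirstOrder.Language

variable {Γ : TreePlan} {S : Type w} (L : Γ.infNodes → FirstOrder.Language.{u, v})

/-! #### Transfer to elementarily equivalent structures -/

section Transfer

variable {α : Type*}

/-- The term `pred t`. -/
def predTerm (t : (starLang Γ L).Term α) : (starLang Γ L).Term α := (predSymb L).apply₁ t

/-- The formula `P_σ(t)`. -/
def projFormula (σ : Γ.nodes) (t : (starLang Γ L).Term α) : (starLang Γ L).Formula α :=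
  (projSymb L σ).formula₁ t

/-- The formula `t ≤ t'`. -/
def leFormula (t t' : (starLang Γ L).Term α) : (starLang Γ L).Formula α :=
  (leSymb L).formula₂ t t'

variable {K : Type*} [(starLang Γ L).Structure K] {L}

@[simp] theorem realize_predTerm (t : (starLang Γ L).Term α) (v : α → K) :
    (predTerm L t).realize v = kpred L (t.realize v) :=
  Term.realize_functions_apply₁

@[simp] theorem realize_predTerm_iterate (m : ℕ) (t : (starLang Γ L).Term α) (v : α → K) :
    ((predTerm L)^[m] t).realize v = (kpred L)^[m] (t.realize v) := by
  induction m with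
  | zero => rfl
  | succ m ih => rw [Function.iterate_succ_apply', Function.iterate_succ_apply',
      realize_predTerm, ih]

@[simp] theorem realize_projFormula (σ : Γ.nodes) (t : (starLang Γ L).Term α) (v : α → K) :
    (projFormula L σ t).Realize v ↔ kproj L σ.1 (t.realize v) := by
  rw [projFormula, Formula.realize_rel₁, kproj]
  exact ⟨fun h => ⟨σ.2, h⟩, fun ⟨_, h⟩ => h⟩

@[simp] theorem realize_leFormula (t t' : (starLang Γ L).Term α) (v : α → K) :
    (leFormula L t t').Realize v ↔ kle L (t.realize v) (t'.realize v) := by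
  rw [leFormula, Formula.realize_rel₂, kle]

@[simp] theorem realize_meetTerm (t t' : (starLang Γ L).Term α) (v : α → K) :
    ((meetSymb L).apply₂ t t').realize v = kmeet L (t.realize v) (t'.realize v) :=
  Term.realize_functions_apply₂

@[simp] theorem realize_rootTerm (v : α → K) :
    (Term.func (rootSymb L) ![] : (starLang Γ L).Term α).realize v = kroot L K := by
  rw [Term.realize_func, kroot]
  congr 1
  exact Subsingleton.elim _ _

theorem realize_hatFormula (σ : Γ.infNodes) {n : ℕ} (R : (L σ).Relations n)
    (t : Fin (n + 1) → (starLang Γ L).Term α) (v : α → K) :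
    ((hatSymb L σ R).formula t).Realize v ↔ khat L σ R fun i => (t i).realize v :=
  Formula.realize_rel

theorem dropLast_mem_nodes (σ : Γ.infNodes) : σ.1.dropLast ∈ Γ.nodes :=
  Γ.dropLast_mem _ (Γ.infNodes_subset σ.2)

open Term in
-- Each clause is the universal closure of a formula. For the order this uses the finite height,
-- which turns the existence of an iterate into a finite disjunction.
theorem IsTree.of_elementarilyEquivalent {K' : Type*} [(starLang Γ L).Structure K']
    (h : K ≅[starLang Γ L] K') (hK : IsTree L K) : IsTree L K' where
  exists_proj x := by
    have := (NIC.forall_realize_iff h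
      (Formula.iSup fun σ : Γ.nodes => projFormula L σ (var (0 : Fin 1)))).1
      (fun v => by simpa using hK.exists_proj (v 0)) ![x]
    simpa using this
  proj_unique {σ τ x} h1 h2 := by
    have := (NIC.forall_realize_iff h
      ((projFormula L ⟨σ, h1.1⟩ (var (0 : Fin 1))).imp
        ((projFormula L ⟨τ, h2.1⟩ (var (0 : Fin 1))).imp
          -- The equality of two indices is not a formula; it is encoded as `⊤` or `⊥`.
          (if σ = τ then (⊤ : (starLang Γ L).Formula (Fin 1)) else ⊥)))).1
      (fun v => by
        simp only [Formula.realize_imp, realize_projFormula, realize_var]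
        intro h1 h2
        rw [if_pos (hK.proj_unique h1 h2)]
        exact Formula.realize_top.2 trivial) ![x]
    simp only [Formula.realize_imp, realize_projFormula, realize_var] at this
    have := this h1 h2
    by_contra hne
    rw [if_neg hne] at this
    exact Formula.realize_bot.1 this
  proj_nil {x} := by
    have := (NIC.forall_realize_iff h
      ((projFormula L ⟨[], Γ.nil_mem⟩ (var (0 : Fin 1))).iff
        ((var 0).equal (Term.func (rootSymb L) ![])))).1
      (fun v => by
        simpa only [Formula.realize_iff, realize_projFormula, realize_var, Formula.realize_equal,
          realize_rootTerm] using hK.proj_nil) ![x]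
    simpa only [Formula.realize_iff, realize_projFormula, realize_var, Formula.realize_equal,
          realize_rootTerm] using! this
  pred_root := by
    have := (NIC.forall_realize_iff h
      ((predTerm L (Term.func (rootSymb L) ![] : (starLang Γ L).Term (Fin 0))).equal
        (Term.func (rootSymb L) ![]))).1
      (fun v => by
        simpa only [realize_predTerm, Formula.realize_equal,
          realize_rootTerm] using hK.pred_root) ![]
    simpa only [realize_predTerm, Formula.realize_equal, realize_rootTerm] using this
  proj_pred {σ k x} h1 := by
    have hσ : σ ∈ Γ.nodes := Γ.mem_of_prefix (List.prefix_append _ _) h1.1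
    have := (NIC.forall_realize_iff h
      ((projFormula L ⟨_, h1.1⟩ (var (0 : Fin 1))).imp
        (projFormula L ⟨_, hσ⟩ (predTerm L (var (0 : Fin 1)))))).1
      (fun v => by
        simpa only [Formula.realize_imp, realize_projFormula, realize_var, realize_predTerm]
          using hK.proj_pred) ![x]
    simp only [Formula.realize_imp, realize_projFormula, realize_var, realize_predTerm] at this
    exact this h1
  le_iff {x y} := by
    have := (NIC.forall_realize_iff h
      ((leFormula L (var (0 : Fin 2)) (var 1)).iff
        (Formula.iSup fun m : Fin (Γ.height + 1) =>
          (var (0 : Fin 2)).equal ((predTerm L)^[m.1] (var 1))))).1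
      (fun v => by
        simpa only [Formula.realize_iff, realize_leFormula, realize_var, Formula.realize_iSup,
          Formula.realize_equal, realize_predTerm_iterate] using hK.le_iff) ![x, y]
    simpa only [Formula.realize_iff, realize_leFormula, realize_var, Formula.realize_iSup,
          Formula.realize_equal, realize_predTerm_iterate] using! this
  le_antisymm {x y} h1 h2 := by
    have := (NIC.forall_realize_iff h
      ((leFormula L (var (0 : Fin 2)) (var 1)).imp
        ((leFormula L (var (1 : Fin 2)) (var 0)).imp ((var 0).equal (var 1))))).1
      (fun v => by
        simpa only [Formula.realize_imp, realize_leFormula, realize_var,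
          Formula.realize_equal] using hK.le_antisymm) ![x, y]
    simp only [Formula.realize_imp, realize_leFormula, realize_var, Formula.realize_equal] at this
    exact this h1 h2
  le_meet {x y z} := by
    have := (NIC.forall_realize_iff h
      ((leFormula L (var (2 : Fin 3)) ((meetSymb L).apply₂ (var 0) (var 1))).iff
        (leFormula L (var (2 : Fin 3)) (var 0) ⊓ leFormula L (var (2 : Fin 3)) (var 1)))).1
      (fun v => by
        simpa only [Formula.realize_iff, realize_leFormula, realize_var, realize_meetTerm,
          Formula.realize_inf] using hK.le_meet) ![x, y, z]
    simpa only [Formula.realize_iff, realize_leFormula, realize_var, realize_meetTerm,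
          Formula.realize_inf] using! this
  exists_star {σ k y} hσ hσ' hy := by
    have := (NIC.forall_realize_iff h
      ((projFormula L ⟨σ, hy.1⟩ (var (0 : Fin 1))).imp
        (Formula.iExs Unit (((predTerm L (var (Sum.inr ()))).equal (var (Sum.inl 0))) ⊓
          projFormula L ⟨_, hσ⟩ (var (Sum.inr ())))))).1
      (fun v => by
        simp only [Formula.realize_imp, realize_projFormula, realize_var, Formula.realize_iExs,
          Formula.realize_inf, Formula.realize_equal, realize_predTerm, Sum.elim_inl, Sum.elim_inr]
        intro hv
        obtain ⟨x, hx⟩ := hK.exists_star hσ hσ' hv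
        exact ⟨fun _ => x, hx⟩) ![y]
    simp only [Formula.realize_imp, realize_projFormula, realize_var, Formula.realize_iExs,
      Formula.realize_inf, Formula.realize_equal, realize_predTerm, Sum.elim_inl,
      Sum.elim_inr] at this
    obtain ⟨x, hx⟩ := this hy
    exact ⟨x (), hx⟩
  star_unique {σ x x'} hσ h1 h2 h3 := by
    have := (NIC.forall_realize_iff h
      ((projFormula L ⟨σ, h1.1⟩ (var (0 : Fin 2))).imp
        ((projFormula L ⟨σ, h1.1⟩ (var (1 : Fin 2))).imp
          (((predTerm L (var 0)).equal (predTerm L (var 1))).imp ((var 0).equal (var 1)))))).1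
      (fun v => by
        simpa only [Formula.realize_imp, realize_projFormula, realize_var, Formula.realize_equal,
          realize_predTerm] using hK.star_unique hσ) ![x, x']
    simp only [Formula.realize_imp, realize_projFormula, realize_var, Formula.realize_equal,
      realize_predTerm] at this
    exact this h1 h2 h3
  of_hat {σ n R x} hR := by
    have := (NIC.forall_realize_iff h
      (((hatSymb L σ R).formula (fun i : Fin (n + 1) => var i)).imp
        (projFormula L ⟨_, dropLast_mem_nodes σ⟩ (var (0 : Fin (n + 1))) ⊓
          Formula.iInf fun i : Fin n => ((predTerm L (var i.succ)).equal (var 0)) ⊓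
            projFormula L ⟨_, Γ.infNodes_subset σ.2⟩ (var i.succ)))).1
      (fun v => by
        simpa only [Formula.realize_imp, realize_projFormula, realize_var, Formula.realize_equal,
          realize_predTerm, Formula.realize_inf, Formula.realize_iInf, realize_hatFormula]
          using hK.of_hat) x
    simp only [Formula.realize_imp, realize_projFormula, realize_var, Formula.realize_equal,
      realize_predTerm, Formula.realize_inf, Formula.realize_iInf, realize_hatFormula] at this
    exact this hR

end Transfer

/-! #### Components -/

section Components

variable {K : Type*} [(starLang Γ L).Structure K]

/-- The component of an `L*`-structure that consists of the elements of `P_σ` with predecessor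
`y`. -/
def Comp (σ : Γ.infNodes) (y : K) : Type _ := {x : K // kpred L x = y ∧ kproj L σ.1 x}

instance [∀ σ, (L σ).IsRelational] (σ : Γ.infNodes) (y : K) :
    (L σ).Structure (Comp L σ y) where
  funMap F := isEmptyElim F
  RelMap R x := khat L σ R (Fin.cons y fun i => (x i).1)

variable [∀ σ, (L σ).IsRelational]

/-- The variable that a term of a relational language is. -/
noncomputable def termVar {L : FirstOrder.Language.{u, v}} [L.IsRelational] {α : Type*}
    (t : L.Term α) : α := (NIC.exists_eq_var t).choose

theorem var_termVar {L : FirstOrder.Language.{u, v}} [L.IsRelational] {α : Type*}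
    (t : L.Term α) : Term.var (termVar t) = t := (NIC.exists_eq_var t).choose_spec.symm

/-- The variable `x` of a relativized formula. -/
def relVar {n : ℕ} (x : Empty ⊕ Fin n) : (starLang Γ L).Term (Unit ⊕ Fin n) :=
  Term.var (Sum.map Empty.elim id x)

/-- The relativization of a formula of `L_σ` to a component. -/
noncomputable def relativize (σ : Γ.infNodes) : ∀ {n : ℕ}, (L σ).BoundedFormula Empty n →
    (starLang Γ L).BoundedFormula Unit n
  | _, .falsum => .falsum
  | _, .equal t₁ t₂ => .equal (relVar L (termVar t₁)) (relVar L (termVar t₂))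
  | _, .rel R ts => (hatSymb L σ R).boundedFormula
      (Fin.cons (Term.var (Sum.inl ())) fun i => relVar L (termVar (ts i)))
  | _, .imp φ ψ => .imp (relativize σ φ) (relativize σ ψ)
  | n, .all φ => .all (BoundedFormula.imp
      ((predTerm L (relVar L (Sum.inr (Fin.last n)))).bdEqual (Term.var (Sum.inl ())) ⊓
        (projSymb L ⟨_, Γ.infNodes_subset σ.2⟩).boundedFormula₁ (relVar L (Sum.inr (Fin.last n))))
      (relativize σ φ))

variable {L}

theorem realize_relativize (σ : Γ.infNodes) (y : K) {n : ℕ} (φ : (L σ).BoundedFormula Empty n)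
    (xs : Fin n → Comp L σ y) :
    (relativize L σ φ).Realize (fun _ => y) (fun i => (xs i).1) ↔ φ.Realize default xs := by
  have hv : ∀ {n : ℕ} (xs : Fin n → Comp L σ y) (t : (L σ).Term (Empty ⊕ Fin n)),
      (relVar L (termVar t)).realize (Sum.elim (fun _ : Unit => y) fun i => (xs i).1) =
        (t.realize (Sum.elim default xs)).1 := by
    intro n xs t
    have h := var_termVar t
    revert h
    generalize termVar t = i
    rintro rfl
    rcases i with i | i
    · exact i.elim
    · rfl
  induction φ with
  | falsum => rfl
  | equal t₁ t₂ =>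
    simp only [relativize, BoundedFormula.Realize, hv]
    exact Subtype.ext_iff.symm
  | rel R ts =>
    simp only [relativize, BoundedFormula.realize_rel]
    change _ ↔ Structure.RelMap (hatSymb L σ R) _
    have : (fun i => Term.realize (Sum.elim (fun _ : Unit => y) fun i => (xs i).1)
        ((Fin.cons (Term.var (Sum.inl ())) fun i => relVar L (termVar (ts i)) :
          Fin _ → (starLang Γ L).Term _) i)) =
        Fin.cons y fun i => ((ts i).realize (Sum.elim default xs)).1 := by
      ext i
      refine Fin.cases rfl (fun i => ?_) i
      simp only [Fin.cons_succ]
      exact hv _ _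
    rw [this]
  | imp φ ψ h1 h2 =>
    simp only [relativize, BoundedFormula.realize_imp, h1, h2]
  | @all n φ ih =>
    simp only [relativize, BoundedFormula.realize_all, BoundedFormula.realize_imp,
      BoundedFormula.realize_inf, BoundedFormula.realize_bdEqual, BoundedFormula.realize_rel₁,
      realize_predTerm]
    have e : ∀ x : K, (relVar L (Sum.inr (Fin.last n))).realize
        (Sum.elim (fun _ : Unit => y) (Fin.snoc (fun i => (xs i).1) x : Fin (n + 1) → K)) = x := by
      intro x
      simp [relVar]
    have e' : ∀ x : Comp L σ y, (Fin.snoc (fun i => (xs i).1) x.1 : Fin (n + 1) → K) =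
        fun i => ((Fin.snoc xs x : Fin (n + 1) → Comp L σ y) i).1 := by
      intro x
      ext i
      refine Fin.lastCases ?_ (fun i => ?_) i <;> simp
    constructor
    · intro H x
      refine (ih _).1 ?_
      rw [← e']
      refine H x.1 ⟨?_, ?_⟩
      · rw [e]
        exact x.2.1
      · rw [e]
        exact x.2.2.2
    · rintro H x ⟨h1, h2⟩
      rw [e] at h1 h2
      let x' : Comp L σ y := ⟨x, h1, Γ.infNodes_subset σ.2, h2⟩
      have := (ih _).2 (H x')
      rwa [← e' x'] at this

/-- That all components at nodes of the right projection satisfy `φ` is expressed by one universally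
quantified relativized formula, so it transfers. -/
theorem comp_models_of_forall {K' : Type*} [(starLang Γ L).Structure K']
    (h : K ≅[starLang Γ L] K') (σ : Γ.infNodes) (φ : (L σ).Sentence)
    (hφ : ∀ y : K, kproj L σ.1.dropLast y → Comp L σ y ⊨ φ) (y : K')
    (hy : kproj L σ.1.dropLast y) : Comp L σ y ⊨ φ := by
  have key : ∀ (A : Type _) [(starLang Γ L).Structure A] (y : A),
      Comp L σ y ⊨ φ ↔ Formula.Realize (relativize L σ φ : (starLang Γ L).Formula Unit)
        fun _ => y := by
    intro A _ y
    rw [Sentence.Realize, Formula.Realize, Formula.Realize,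
      ← realize_relativize σ y φ default]
    congr! 1
  have key' : ∀ (A : Type _) [(starLang Γ L).Structure A] (y : A),
      Comp L σ y ⊨ φ ↔ Formula.Realize (relativize L σ φ : (starLang Γ L).Formula Unit)
        fun _ => y := by
    intro A _ y
    rw [Sentence.Realize, Formula.Realize, Formula.Realize,
      ← realize_relativize σ y φ default]
    congr! 1
  have := (NIC.forall_realize_iff h
    ((projFormula L ⟨_, dropLast_mem_nodes σ⟩ (Term.var ())).imp (relativize L σ φ))).1
    (fun v => by
      rw [Formula.realize_imp, realize_projFormula]
      intro hv
      exact (key _ _).1 (hφ _ hv)) (fun _ => y)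
  rw [Formula.realize_imp, realize_projFormula] at this
  exact (key' _ _).2 (this hy)

variable {N : Γ.infNodes → Type w} [∀ σ, (L σ).Structure (N σ)] {f : ∀ σ, S ≃ N σ}
  [(starLang Γ L).Structure (Γ.Node S)]

theorem exists_eq_dropLast_append (σ : Γ.infNodes) : ∃ k, σ.1 = σ.1.dropLast ++ [k] :=
  ⟨σ.1.getLast fun h => Γ.nil_notMem_infNodes (h ▸ σ.2), by rw [List.dropLast_append_getLast]⟩

/-- The node `b⌢(k, s)`. -/
def Node.snoc (b : Γ.Node S) (k : ℕ) (h : b.proj ++ [k] ∈ Γ.infNodes) (s : S) : Γ.Node S :=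
  ⟨b.1 ++ [(k, some s)],
    isNode_concat_iff.2 ⟨b.2, Γ.infNodes_subset h, by simpa using! h⟩⟩

theorem Node.snoc_val (b : Γ.Node S) (k : ℕ) (h : b.proj ++ [k] ∈ Γ.infNodes) (s : S) :
    (b.snoc k h s).1 = b.1 ++ [(k, some s)] := rfl

theorem IsGlued.exists_comp_equiv (hM : IsGlued L N f) (σ : Γ.infNodes) (b : Γ.Node S)
    (hb : b.proj = σ.1.dropLast) : Nonempty (N σ ≃[L σ] Comp L σ b) := by
  obtain ⟨k, hk⟩ := exists_eq_dropLast_append σ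
  have hk' : b.proj ++ [k] = σ.1 := by rw [hb, ← hk]
  have hinf : b.proj ++ [k] ∈ Γ.infNodes := hk' ▸ σ.2
  let g : N σ → Comp L σ b := fun x => ⟨b.snoc k hinf ((f σ).symm x), by
    rw [hM.kpred_eq, hM.kproj_iff]
    exact ⟨Node.pred_concat rfl, (Node.proj_concat rfl).trans hk'⟩⟩
  have hg : Function.Bijective g := by
    constructor
    · intro x x' h
      have h' : b.1 ++ [(k, some ((f σ).symm x))] = b.1 ++ [(k, some ((f σ).symm x'))] :=
        congrArg (fun z : Comp L σ b => z.1.1) h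
      simpa using h'
    · rintro ⟨x, hx, hx'⟩
      rw [hM.kpred_eq] at hx
      rw [hM.kproj_iff] at hx'
      obtain ⟨s, hs⟩ := Node.exists_eq_concat_some (hx'.trans hk'.symm) (hx' ▸ σ.2)
      refine ⟨f σ s, Subtype.ext (Node.ext ?_)⟩
      simp only [g, Node.snoc, Equiv.symm_apply_apply]
      rw [hs, hx]
  refine ⟨⟨Equiv.ofBijective g hg, fun F => isEmptyElim F, fun {n} R x => ?_⟩⟩
  change khat L σ R _ ↔ _
  rw [hM.khat_iff]
  constructor
  · rintro ⟨k', s, -, hs, hR⟩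
    convert hR using 2 with i
    have : b.1 ++ [(k, some ((f σ).symm (x i)))] = b.1 ++ [(k', some (s i))] := hs i
    simp only [List.append_cancel_left_eq, List.cons.injEq, Prod.mk.injEq, Option.some.injEq,
      and_true] at this
    rw [← this.2, Equiv.apply_symm_apply]
  · intro hR
    exact ⟨k, fun i => (f σ).symm (x i), hk'.symm, fun i => rfl, by simpa using hR⟩

/-- In the glued structure every component for `σ` is a copy of `N σ`, so each sentence true in `N
σ` holds in all of them and then in all components of `K`; negations give the converse. -/
theorem IsGlued.comp_elementarilyEquivalent (hM : IsGlued L N f)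
    (h : Γ.Node S ≅[starLang Γ L] K) (σ : Γ.infNodes) (y : K) (hy : kproj L σ.1.dropLast y) :
    N σ ≅[L σ] Comp L σ y := by
  have key : ∀ φ : (L σ).Sentence, N σ ⊨ φ → Comp L σ y ⊨ φ := by
    intro φ hφ
    refine comp_models_of_forall h σ φ (fun b hb => ?_) y hy
    obtain ⟨e⟩ := hM.exists_comp_equiv σ b ((hM.kproj_iff _ _).1 hb)
    exact (StrongHomClass.realize_sentence e φ).1 hφ
  rw [elementarilyEquivalent_iff]
  refine fun φ => ⟨key φ, fun h => ?_⟩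
  by_contra h'
  exact (Sentence.realize_not _).1 (key (∼φ) ((Sentence.realize_not _).2 h')) h

/-- The components of `K` are countably infinite models of the `T σ`, hence isomorphic to the `N σ`
by categoricity. One isomorphism per component yields coherent `ComponentMaps`. -/
theorem IsGlued.nonempty_equiv {K : Type w} [(starLang Γ L).Structure K] [Countable K]
    [Infinite S] (hM : IsGlued L N f) (T : ∀ σ, (L σ).Theory) [hT : ∀ σ, N σ ⊨ T σ]
    [Countable S]
    (hcat : ∀ σ, Cardinal.Categorical (Cardinal.aleph0.{w}) (T σ))
    (h : Γ.Node S ≅[starLang Γ L] K) : Nonempty (Γ.Node S ≃[starLang Γ L] K) := by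
  classical
  have iso : ∀ (σ : Γ.infNodes) (y : K), kproj L σ.1.dropLast y →
      Nonempty (N σ ≃[L σ] Comp L σ y) := by
    intro σ y hy
    have hNi : Infinite (N σ) := (f σ).infinite_iff.1 inferInstance
    have hNc : Countable (N σ) := (f σ).symm.injective.countable
    have he := hM.comp_elementarilyEquivalent h σ y hy
    have hi : Infinite (Comp L σ y) := he.infinite_iff.1 hNi
    have hc : Countable (Comp L σ y) := Subtype.countable
    have hm : Comp L σ y ⊨ T σ := he.theory_model_iff.1 (hT σ)
    exact hcat σ (Theory.ModelType.of _ (N σ)) (Theory.ModelType.of _ (Comp L σ y))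
      (Cardinal.mk_eq_aleph0 (N σ)) (Cardinal.mk_eq_aleph0 (Comp L σ y))
  have g := fun σ y hy => (iso σ y hy).some
  -- The default `y` is never met at nodes of the tree, where `y` has the projection that `σ`
  -- requires.
  let c : List (ℕ × Option S) → K → Γ.infNodes → S → K := fun _ y σ s =>
    if hy : kproj L σ.1.dropLast y then (g σ y hy (f σ s)).1 else y
  have hc : ∀ l y σ s (hy : kproj L σ.1.dropLast y), c l y σ s = (g σ y hy (f σ s)).1 :=
    fun l y σ s hy => dif_pos hy
  have hdrop : ∀ {a : Γ.Node S} {y : K} {σ : Γ.infNodes} {k : ℕ}, σ.1 = a.proj ++ [k] →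
      kproj L a.proj y → kproj L σ.1.dropLast y := by
    intro a y σ k hσ hy
    rwa [hσ, List.dropLast_concat]
  have hcm : ComponentMaps L c := by
    refine ⟨?_, ?_, ?_⟩
    · intro a y σ k hσ hy s s' hs
      rw [hc a.1 _ _ _ (hdrop hσ hy), hc a.1 _ _ _ (hdrop hσ hy)] at hs
      exact (f σ).injective ((g σ y _).injective (Subtype.ext hs))
    · intro a y σ k hσ hy s
      rw [hc a.1 _ _ _ (hdrop hσ hy)]
      exact (g σ y _ (f σ s)).2
    · intro a y σ k hσ hy x hx hx'
      refine ⟨(f σ).symm ((g σ y (hdrop hσ hy)).symm ⟨x, hx, hx'⟩), ?_⟩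
      rw [hc a.1 _ _ _ (hdrop hσ hy)]
      rw [Equiv.apply_symm_apply]
      exact congrArg Subtype.val ((g σ y (hdrop hσ hy)).apply_symm_apply ⟨x, hx, hx'⟩)
  obtain ⟨e, -⟩ := hM.exists_equiv (hM.isTree.of_elementarilyEquivalent h) hcm (by
    intro a y σ k hσ hy n R s
    rw [← StrongHomClass.map_rel (g σ y (hdrop hσ hy)) R]
    change khat L σ R _ ↔ _
    simp only [hc a.1 _ _ _ (hdrop hσ hy)]
    rfl)
  exact ⟨e⟩

end Components

end TreePlan

namespace NIC

open FirstOrder FirstOrder.Language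

/-- Finite partial isomorphisms extend to automorphisms. -/
def IsHomogeneous (L : FirstOrder.Language.{u, v}) (N : Type w) [L.Structure N] : Prop :=
  ∀ p : Set (N × N), p.Finite → IsPartialIso L p → ∃ g : N ≃[L] N, ∀ x ∈ p, g x.1 = x.2

end NIC

namespace TreePlan

open FirstOrder FirstOrder.Language

variable {Γ : TreePlan} {S : Type w} {L : Γ.infNodes → FirstOrder.Language.{u, v}}
  {N : Γ.infNodes → Type w} [∀ σ, (L σ).Structure (N σ)] {f : ∀ σ, S ≃ N σ}
  [(starLang Γ L).Structure (Γ.Node S)]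

/-! #### Automorphisms of the glued structure -/

theorem map_kpred {K K' : Type*} [(starLang Γ L).Structure K] [(starLang Γ L).Structure K']
    (e : K ≃[starLang Γ L] K') (x : K) : e (kpred L x) = kpred L (e x) := by
  rw [kpred, StrongHomClass.map_fun, kpred]
  congr 1
  ext i
  fin_cases i
  rfl

theorem kproj_map {K K' : Type*} [(starLang Γ L).Structure K] [(starLang Γ L).Structure K']
    (e : K ≃[starLang Γ L] K') (σ : List ℕ) (x : K) : kproj L σ (e x) ↔ kproj L σ x := by
  refine exists_congr fun h => ?_
  rw [← StrongHomClass.map_rel e]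
  have : (e ∘ ![x]) = ![e x] := by
    ext i
    fin_cases i
    rfl
  rw [this]

theorem IsGlued.map_pred (hM : IsGlued L N f) (e : Γ.Node S ≃[starLang Γ L] Γ.Node S)
    (x : Γ.Node S) : e x.pred = (e x).pred := by
  rw [← hM.kpred_eq, ← hM.kpred_eq, map_kpred]

theorem IsGlued.proj_map (hM : IsGlued L N f) (e : Γ.Node S ≃[starLang Γ L] Γ.Node S)
    (x : Γ.Node S) : (e x).proj = x.proj := by
  rw [← hM.kproj_iff, kproj_map, hM.kproj_iff]

theorem IsGlued.map_root (hM : IsGlued L N f) (e : Γ.Node S ≃[starLang Γ L] Γ.Node S) :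
    e Node.root = Node.root :=
  Node.eq_root_of_proj (hM.proj_map e _)

theorem IsGlued.map_pred_iterate (hM : IsGlued L N f) (e : Γ.Node S ≃[starLang Γ L] Γ.Node S)
    (m : ℕ) (x : Γ.Node S) : e (Node.pred^[m] x) = Node.pred^[m] (e x) := by
  induction m with
  | zero => rfl
  | succ m ih => rw [Function.iterate_succ_apply', Function.iterate_succ_apply', hM.map_pred, ih]

theorem Node.length_proj (x : Γ.Node S) : x.proj.length = x.1.length := by
  simp [Node.proj]

theorem IsGlued.map_le (hM : IsGlued L N f) (e : Γ.Node S ≃[starLang Γ L] Γ.Node S)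
    {x y : Γ.Node S} (h : x ≤ y) : e x ≤ e y := by
  rw [Node.le_iff_exists_pred] at h ⊢
  obtain ⟨m, hm, rfl⟩ := h
  refine ⟨m, ?_, hM.map_pred_iterate e m y⟩
  rwa [← Node.length_proj, hM.proj_map, Node.length_proj]

theorem IsGlued.khat_concat (hM : IsGlued L N f) {σ : Γ.infNodes} {b : Γ.Node S} {k : ℕ}
    (hσ : σ.1 = b.proj ++ [k]) {n : ℕ} (R : (L σ).Relations n) {x : Fin n → Γ.Node S}
    {s : Fin n → S} (hx : ∀ i, (x i).1 = b.1 ++ [(k, some (s i))]) :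
    khat L σ R (Fin.cons b x : Fin (n + 1) → Γ.Node S) ↔
      Structure.RelMap R fun i => f σ (s i) := by
  rw [hM.khat_iff]
  constructor
  · rintro ⟨k', s', -, hs, hR⟩
    convert hR using 3 with i
    have : b.1 ++ [(k, some (s i))] = b.1 ++ [(k', some (s' i))] := (hx i).symm.trans (hs i)
    have h2 : k = k' ∧ s i = s' i := by simpa using List.append_cancel_left this
    exact h2.2
  · exact fun hR => ⟨k, s, hσ, hx, hR⟩

/-- The automorphisms may be chosen independently at all nodes, because no relation links two
components. The children of `a` are permuted by `g a σ` while `a` itself travels to `e a`. -/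
theorem IsGlued.exists_aut (hM : IsGlued L N f) (g : Γ.Node S → ∀ σ, N σ ≃[L σ] N σ) :
    ∃ e : Γ.Node S ≃[starLang Γ L] Γ.Node S, ∀ (a a' : Γ.Node S) (k : ℕ) (s : S)
      (σ : Γ.infNodes), σ.1 = a.proj ++ [k] → a'.1 = a.1 ++ [(k, some s)] →
      (e a').1 = (e a).1 ++ [(k, some ((f σ).symm (g a σ (f σ s))))] := by
  classical
  -- The index `k` of the new entry is recovered as the last entry of `σ`; the default `y` plays no
  -- role.
  let h : List (ℕ × Option S) → Γ.Node S → Γ.infNodes → S → Γ.Node S := fun l y σ s =>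
    if hl : Γ.IsNode S l ∧ y.proj ++ [σ.1.getLastD 0] ∈ Γ.infNodes then
      y.snoc _ hl.2 ((f σ).symm (g ⟨l, hl.1⟩ σ (f σ s))) else y
  have hval : ∀ {a y : Γ.Node S} {σ : Γ.infNodes} {k : ℕ}, σ.1 = a.proj ++ [k] →
      kproj L a.proj y → ∀ s,
        (h a.1 y σ s).1 = y.1 ++ [(k, some ((f σ).symm (g a σ (f σ s))))] := by
    intro a y σ k hσ hy s
    have hk : σ.1.getLastD 0 = k := by rw [hσ]; simp
    have hy' : y.proj = a.proj := (hM.kproj_iff _ _).1 hy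
    have hl : Γ.IsNode S a.1 ∧ y.proj ++ [σ.1.getLastD 0] ∈ Γ.infNodes :=
      ⟨a.2, by rw [hk, hy', ← hσ]; exact σ.2⟩
    have : h a.1 y σ s = y.snoc _ hl.2 ((f σ).symm (g a σ (f σ s))) := dif_pos hl
    rw [this, Node.snoc_val, hk]
  have hmem : ∀ {a y : Γ.Node S} {σ : Γ.infNodes} {k : ℕ}, σ.1 = a.proj ++ [k] →
      kproj L a.proj y → ∀ s, (h a.1 y σ s).pred = y ∧ (h a.1 y σ s).proj = σ.1 := by
    intro a y σ k hσ hy s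
    refine ⟨Node.pred_concat (hval hσ hy s), ?_⟩
    rw [Node.proj_concat (hval hσ hy s), hσ, (hM.kproj_iff _ _).1 hy]
  have hh : ComponentMaps L h := by
    refine ⟨fun a y σ k hσ hy s s' hs => ?_, fun a y σ k hσ hy s => ?_,
      fun a y σ k hσ hy x hx hx' => ?_⟩
    · have := congrArg Subtype.val hs
      change (h a.1 y σ s).1 = (h a.1 y σ s').1 at this
      rw [hval hσ hy, hval hσ hy] at this
      simpa using this
    · rw [hM.kpred_eq, hM.kproj_iff]
      exact hmem hσ hy s
    · rw [hM.kpred_eq] at hx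
      rw [hM.kproj_iff] at hx'
      obtain ⟨s, hs⟩ := Node.exists_eq_concat_some (hx'.trans hσ) (hx' ▸ σ.2)
      refine ⟨(f σ).symm ((g a σ).symm (f σ s)), Node.ext ?_⟩
      rw [hval hσ hy, hs, hx]
      simp
  obtain ⟨e, he⟩ := hM.exists_equiv hM.isTree hh (by
    intro a y σ k hσ hy n R s
    have hσ' : σ.1 = y.proj ++ [k] := by rw [hσ, (hM.kproj_iff _ _).1 hy]
    rw [hM.khat_concat hσ' R fun i => hval hσ hy (s i)]
    simp only [Equiv.apply_symm_apply]
    exact (StrongHomClass.map_rel (g a σ) R _).symm)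
  refine ⟨e, fun a a' k s σ hσ ha => ?_⟩
  rw [he, ha, embed_concat, child_some a _ s hσ, ← he]
  refine hval hσ ?_ s
  rw [hM.kproj_iff, hM.proj_map]

theorem IsGlued.eq_concat_none (hM : IsGlued L N f) (e : Γ.Node S ≃[starLang Γ L] Γ.Node S)
    {a a' : Γ.Node S} {k : ℕ} (h : a'.1 = a.1 ++ [(k, none)]) :
    (e a').1 = (e a).1 ++ [(k, none)] := by
  have h2 := a'.2
  rw [h, isNode_concat_iff] at h2
  have hn : a.proj ++ [k] ∉ Γ.infNodes := by simpa using! h2.2.2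
  have hp : (e a').proj = a.proj ++ [k] := by rw [hM.proj_map, Node.proj_concat h]
  rw [Node.eq_concat_none hp (by rwa [hp]), ← hM.map_pred, Node.pred_concat h]

/-- A finite relation that is closed under predecessors and preserves the basic relations extends
to an automorphism. -/
theorem IsGlued.exists_aut_extending (hM : IsGlued L N f)
    (hN : ∀ σ, NIC.IsHomogeneous (L σ) (N σ)) {Q : Set (Γ.Node S × Γ.Node S)} (hQ : Q.Finite)
    (hpred : ∀ x ∈ Q, (x.1.pred, x.2.pred) ∈ Q) (hproj : ∀ x ∈ Q, x.1.proj = x.2.proj)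
    (hinj : ∀ x ∈ Q, ∀ y ∈ Q, x.1 = y.1 ↔ x.2 = y.2)
    (hhat : ∀ (σ : Γ.infNodes) (n : ℕ) (R : (L σ).Relations n)
      (x : Fin (n + 1) → Γ.Node S × Γ.Node S), (∀ i, x i ∈ Q) →
      (khat L σ R (fun i => (x i).1) ↔ khat L σ R fun i => (x i).2)) :
    ∃ e : Γ.Node S ≃[starLang Γ L] Γ.Node S, ∀ x ∈ Q, e x.1 = x.2 := by
  -- `p b σ` is the map that `Q` induces from the component for `σ` at `b` to the one at the partner
  -- `c` of `b`, both read in `N σ`.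
  let p : Γ.Node S → ∀ σ, Set (N σ × N σ) := fun b σ =>
    {z | ∃ x ∈ Q, ∃ (k : ℕ) (c : Γ.Node S), σ.1 = b.proj ++ [k] ∧ (b, c) ∈ Q ∧
      x.1.1 = b.1 ++ [(k, some ((f σ).symm z.1))] ∧ x.2.1 = c.1 ++ [(k, some ((f σ).symm z.2))]}
  have hpfin : ∀ b σ, (p b σ).Finite := by
    intro b σ
    have : p b σ = ⋃ x ∈ Q, {z | ∃ (k : ℕ) (c : Γ.Node S), σ.1 = b.proj ++ [k] ∧ (b, c) ∈ Q ∧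
        x.1.1 = b.1 ++ [(k, some ((f σ).symm z.1))] ∧
        x.2.1 = c.1 ++ [(k, some ((f σ).symm z.2))]} := by
      ext z
      simp [p]
    rw [this]
    refine hQ.biUnion fun x _ => Set.Subsingleton.finite ?_
    rintro ⟨z1, z2⟩ ⟨k, c, -, -, h1, h2⟩ ⟨z1', z2'⟩ ⟨k', c', -, -, h1', h2'⟩
    rw [h1] at h1'
    rw [h2] at h2'
    have e1 := List.append_inj_right' h1' rfl
    have e2 := List.append_inj_right' h2' rfl
    simp only [List.cons.injEq, Prod.mk.injEq, Option.some.injEq, EmbeddingLike.apply_eq_iff_eq,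
      and_true] at e1 e2
    rw [e1.2, e2.2]
  have hp : ∀ b σ, NIC.IsPartialIso (L σ) (p b σ) := by
    intro b σ
    constructor
    · rintro z ⟨x, hx, k, c, hσ, hc, h1, h2⟩ z' ⟨x', hx', k', c', hσ', hc', h1', h2'⟩
      obtain rfl : k = k' := by simpa using hσ.symm.trans hσ'
      obtain rfl : c = c' := (hinj _ hc _ hc').1 rfl
      have := hinj x hx x' hx'
      rw [Node.ext_iff, Node.ext_iff, h1, h1', h2, h2'] at this
      simpa using this
    · intro n R z hz
      -- For a nullary relation both tuples are empty. Otherwise the entry with index 0 supplies a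
      -- common `k` and `c`.
      rcases n with _ | n
      · rw [Subsingleton.elim (fun i => (z i).1) fun i => (z i).2]
      choose x hx k c hσ hc h1 h2 using hz
      have hk : ∀ i, k i = k 0 := fun i => by simpa using (hσ i).symm.trans (hσ 0)
      have hcc : ∀ i, c i = c 0 := fun i => (hinj _ (hc i) _ (hc 0)).1 rfl
      have hσ' : σ.1 = (c 0).proj ++ [k 0] := by rw [hσ 0, hproj _ (hc 0)]
      have key := hhat σ _ R (Fin.cons (b, c 0) x) (by
        intro i
        exact Fin.cases (hc 0) hx i)
      have e1 : (fun i => ((Fin.cons (b, c 0) x : Fin (n + 2) → _) i).1) =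
          (Fin.cons b fun i => (x i).1 : Fin (n + 2) → Γ.Node S) := by
        ext1 i
        exact Fin.cases rfl (fun _ => rfl) i
      have e2 : (fun i => ((Fin.cons (b, c 0) x : Fin (n + 2) → _) i).2) =
          (Fin.cons (c 0) fun i => (x i).2 : Fin (n + 2) → Γ.Node S) := by
        ext1 i
        exact Fin.cases rfl (fun _ => rfl) i
      rw [e1, e2, hM.khat_concat (hσ 0) R fun i => (h1 i).trans (by rw [hk i]),
        hM.khat_concat hσ' R fun i => (h2 i).trans (by rw [hk i, hcc i])] at key
      simpa using key
  choose g hg using fun b σ => hN σ (p b σ) (hpfin b σ) (hp b σ)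
  obtain ⟨e, he⟩ := hM.exists_aut g
  refine ⟨e, ?_⟩
  -- Induction from the root upwards: closure of `Q` under predecessors makes the parent available,
  -- and the last entry is moved by `g` or is `⋆`.
  have main : ∀ (τ : List ℕ), ∀ x ∈ Q, x.1.proj = τ → e x.1 = x.2 := by
    intro τ
    induction τ using List.reverseRecOn with
    | nil =>
      intro x hx hτ
      rw [Node.eq_root_of_proj hτ, hM.map_root,
        Node.eq_root_of_proj ((hproj x hx).symm.trans hτ)]
    | append_singleton τ k ih =>
      intro x hx hτ
      have hτ2 : x.2.proj = τ ++ [k] := (hproj x hx).symm.trans hτ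
      have hp1 : x.1.pred.proj = τ := by rw [Node.proj_pred, hτ, List.dropLast_concat]
      have ih' : e x.1.pred = x.2.pred := ih _ (hpred x hx) hp1
      by_cases hinf : x.1.proj ∈ Γ.infNodes
      · obtain ⟨s, hs⟩ := Node.exists_eq_concat_some hτ hinf
        obtain ⟨s', hs'⟩ := Node.exists_eq_concat_some hτ2 (hproj x hx ▸ hinf)
        have hσ : x.1.proj = x.1.pred.proj ++ [k] := by rw [hτ, hp1]
        have hgs : g x.1.pred ⟨_, hinf⟩ (f ⟨_, hinf⟩ s) = f ⟨_, hinf⟩ s' :=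
          hg x.1.pred ⟨_, hinf⟩ (f ⟨_, hinf⟩ s, f ⟨_, hinf⟩ s')
            ⟨x, hx, k, x.2.pred, hσ, hpred x hx, by simpa using hs, by simpa using hs'⟩
        have := he x.1.pred x.1 k s ⟨_, hinf⟩ hσ hs
        rw [hgs, Equiv.symm_apply_apply, ih', ← hs'] at this
        exact Node.ext this
      · have hn1 := Node.eq_concat_none hτ hinf
        have hn2 := Node.eq_concat_none hτ2 (hproj x hx ▸ hinf)
        ext1
        rw [hM.eq_concat_none e hn1, ih', ← hn2]
  exact fun x hx => main _ x hx rfl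

/-- An automorphism of one component extends to an automorphism that fixes everything else. -/
theorem IsGlued.exists_aut_component (hM : IsGlued L N f) {b : Γ.Node S} {k : ℕ}
    {σ : Γ.infNodes} (hσ : σ.1 = b.proj ++ [k]) (g : N σ ≃[L σ] N σ) :
    ∃ e : Γ.Node S ≃[starLang Γ L] Γ.Node S,
      (∀ x : Γ.Node S, (∀ s, b.1 ++ [(k, some s)] <+: x.1 → g (f σ s) = f σ s) → e x = x) ∧
      ∀ (x : Γ.Node S) (s : S), b.1 ++ [(k, some s)] <+: x.1 →
        b.1 ++ [(k, some ((f σ).symm (g (f σ s))))] <+: (e x).1 := by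
  classical
  -- The automorphism `g` acts at the one node `b` and index `σ`, and the identity acts everywhere
  -- else.
  let G : Γ.Node S → ∀ σ, N σ ≃[L σ] N σ := fun a τ =>
    if h : a = b ∧ σ = τ then h.2 ▸ g else Language.Equiv.refl _ _
  have hG1 : G b σ = g := dif_pos ⟨rfl, rfl⟩
  have hG2 : ∀ a τ x, ¬ (a = b ∧ σ = τ) → G a τ x = x := by
    intro a τ x h
    have : G a τ = Language.Equiv.refl _ _ := dif_neg h
    rw [this]
    rfl
  obtain ⟨e, he⟩ := hM.exists_aut G
  have hfix : ∀ x : Γ.Node S,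
      (∀ s, b.1 ++ [(k, some s)] <+: x.1 → g (f σ s) = f σ s) → e x = x := by
    have main : ∀ (τ : List ℕ) (x : Γ.Node S), x.proj = τ →
        (∀ s, b.1 ++ [(k, some s)] <+: x.1 → g (f σ s) = f σ s) → e x = x := by
      intro τ
      induction τ using List.reverseRecOn with
      | nil =>
        intro x hx _
        rw [Node.eq_root_of_proj hx, hM.map_root]
      | append_singleton τ j ih =>
        intro x hx hfix
        have hp : x.pred.proj = τ := by rw [Node.proj_pred, hx, List.dropLast_concat]
        have ih' : e x.pred = x.pred := ih _ hp fun s hs =>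
          hfix s (hs.trans (List.dropLast_prefix _))
        by_cases hinf : x.proj ∈ Γ.infNodes
        · obtain ⟨s, hs⟩ := Node.exists_eq_concat_some hx hinf
          have hτ : x.proj = x.pred.proj ++ [j] := by rw [hx, hp]
          have := he x.pred x j s ⟨_, hinf⟩ hτ hs
          ext1
          rw [this, ih']
          have hgs : G x.pred ⟨_, hinf⟩ (f ⟨_, hinf⟩ s) = f ⟨_, hinf⟩ s := by
            by_cases hb : x.pred = b ∧ σ = ⟨_, hinf⟩
            · obtain ⟨hb, rfl⟩ := hb
              have hjk : k = j := by
                have : x.proj = b.proj ++ [k] := hσ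
                rw [hτ, hb] at this
                simpa using this.symm
              subst hjk
              rw [hb, hG1]
              exact hfix s (by rw [hs, hb])
            · exact hG2 _ _ _ hb
          rw [hgs, Equiv.symm_apply_apply, ← hs]
        · have hn := Node.eq_concat_none hx hinf
          ext1
          rw [hM.eq_concat_none e hn, ih', ← hn]
    exact fun x => main _ x rfl
  refine ⟨e, hfix, fun x s hs => ?_⟩
  -- A node is too short to extend its own child, so the condition for being fixed is vacuous at
  -- `b`.
  have heb : e b = b := hfix b fun s hs => by
    have := hs.length_le
    simp at this
  let c : Γ.Node S := ⟨_, x.2.of_prefix hs⟩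
  have hc := he b c k s σ hσ rfl
  rw [hG1, heb] at hc
  rw [← hc]
  exact hM.map_le e (x := c) (y := x) hs

end TreePlan

/-! ### Automorphisms and definable sets -/

namespace NIC

open FirstOrder FirstOrder.Language

section ModelTheory

variable {L : FirstOrder.Language.{u, v}} {M : Type w} [L.Structure M]

theorem mem_iff_of_definable {A : Set M} (e : M ≃[L] M) (he : ∀ a ∈ A, e a = a) {α : Type*}
    {D : Set (α → M)} (hD : A.Definable L D) (x : α → M) : x ∈ D ↔ e ∘ x ∈ D := by
  rw [Set.definable_iff_exists_formula_sum] at hD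
  obtain ⟨φ, rfl⟩ := hD
  rw [Set.mem_ofPred_eq, Set.mem_ofPred_eq, ← StrongHomClass.realize_formula e]
  congr! 1
  ext (i | i)
  · exact he _ i.2
  · rfl

theorem realizes_tp_of_equiv {A : Set M} (e : M ≃[L] M) (he : ∀ a ∈ A, e a = a) (x : M) :
    Realizes (tp L A x) (e x) := by
  intro φ hφ
  exact (mem_iff_of_definable e he (D := {v : Fin 1 → M | φ.Realize v}) ⟨φ, rfl⟩ fun _ => x).1 hφ

/-- Transitivity of definable closure; it carries the induction over the stages of `tcl`. -/
theorem definable_singleton_of_formula {B : Set M} {x y : M} (hx : B.Definable₁ L {x})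
    (θ : L.Formula (Fin 2)) (hθ : ∀ z, θ.Realize ![x, z] ↔ z = y) : B.Definable₁ L {y} := by
  rw [Set.Definable₁, Set.definable_iff_exists_formula_sum] at hx ⊢
  obtain ⟨φ, hφ⟩ := hx
  refine ⟨Formula.iExs Unit (φ.relabel (Sum.elim (fun b => Sum.inl (Sum.inl b))
      fun _ => Sum.inr ()) ⊓ θ.relabel ![Sum.inr (), Sum.inl (Sum.inr 0)]), ?_⟩
  ext v
  simp only [Set.mem_ofPred_eq, Set.mem_singleton_iff, Formula.realize_iExs, Formula.realize_inf,
    Formula.realize_relabel]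
  have h1 : ∀ i : Unit → M, φ.Realize ((Sum.elim (Sum.elim (fun b : B => (b : M)) v) i) ∘
      (Sum.elim (fun b => Sum.inl (Sum.inl b)) fun _ => Sum.inr ())) ↔ i () = x := by
    intro i
    have := Set.ext_iff.1 hφ fun _ => i ()
    simp only [Set.mem_ofPred_eq, Set.mem_singleton_iff] at this
    rw [this]
    congr! 1
    ext (j | j) <;> rfl
  have h2 : ∀ i : Unit → M, θ.Realize ((Sum.elim (Sum.elim (fun b : B => (b : M)) v) i) ∘
      ![Sum.inr (), Sum.inl (Sum.inr 0)]) ↔ θ.Realize ![i (), v 0] := by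
    intro i
    congr! 1
    ext j
    fin_cases j <;> rfl
  simp only [h1, h2]
  constructor
  · intro hv
    exact ⟨fun _ => x, rfl, (hθ _).2 hv⟩
  · rintro ⟨i, hi, hv⟩
    rw [hi] at hv
    exact (hθ _).1 hv

theorem IsPartialIso.refl (s : Set M) : IsPartialIso L {z : M × M | z.1 ∈ s ∧ z.2 = z.1} := by
  constructor
  · rintro x ⟨-, hx⟩ y ⟨-, hy⟩
    rw [hx, hy]
  · intro n R x hx
    have : (fun i => (x i).2) = fun i => (x i).1 := funext fun i => (hx i).2
    rw [this]

/-- With a single 1-type, any two elements satisfy the same formulas in one variable, in particular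
the relations on constant tuples. -/
theorem isPartialIso_singleton {T : L.Theory} [M ⊨ T] [Nonempty M]
    (hone : Nat.card (T.CompleteType (Fin 1)) = 1) (x y : M) : IsPartialIso L {(x, y)} := by
  have hsub : Subsingleton (T.CompleteType (Fin 1)) := (Nat.card_eq_one_iff_unique.1 hone).1
  have ht : ∀ φ : L.Formula (Fin 1), φ.Realize (fun _ => x) ↔ φ.Realize fun _ => y := by
    intro φ
    rw [← Theory.CompleteType.formula_mem_typeOf (T := T),
      ← Theory.CompleteType.formula_mem_typeOf (T := T), Subsingleton.elim (T.typeOf fun _ => x)]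
  constructor
  · rintro _ rfl _ rfl
    simp
  · intro n R z hz
    obtain rfl : z = fun _ => (x, y) := funext hz
    simpa [Formula.realize_rel] using ht (R.formula fun _ => Term.var 0)

end ModelTheory

end NIC

namespace TreePlan

open FirstOrder FirstOrder.Language

variable {Γ : TreePlan} {S : Type w} {L : Γ.infNodes → FirstOrder.Language.{u, v}}

/-! #### Countability of `L*` -/

instance (n : ℕ) : Subsingleton (TreeFunction n) :=
  ⟨fun a b => by cases a <;> cases b <;> rfl⟩

instance (n : ℕ) : Countable (Γ.TreeRelation n) := by
  let F : Γ.TreeRelation n → Option Γ.nodes := fun R =>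
    match R with
    | .le => none
    | .P σ => some σ
  refine Function.Injective.countable (f := F) fun a b h => ?_
  cases a with
  | le => cases b; rfl
  | P σ => cases b; simpa [F] using h

theorem countable_relations {L : FirstOrder.Language.{u, v}} [h : Countable L.Symbols] :
    Countable (Σ n, L.Relations n) :=
  Function.Injective.countable (β := L.Symbols) Sum.inr_injective

instance [∀ σ, Countable (L σ).Symbols] (n : ℕ) : Countable (HatRelation Γ L n) := by
  have := fun σ => countable_relations (L := L σ)
  let F : HatRelation Γ L n → Σ σ, Σ m, (L σ).Relations m := fun R =>
    match R with
    | .hat (n := m) σ R => ⟨σ, m, R⟩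
  refine Function.Injective.countable (f := F) fun a b h => ?_
  cases a
  cases b
  simp only [F, Sigma.mk.injEq] at h
  obtain ⟨rfl, h⟩ := h
  have h := eq_of_heq h
  simp only [Sigma.mk.injEq, heq_eq_eq, true_and] at h
  rw [h]

instance [∀ σ, Countable (L σ).Symbols] : Countable (starLang Γ L).Symbols := by
  have h1 : ∀ n, Countable ((starLang Γ L).Functions n) := fun n =>
    inferInstanceAs (Countable (TreeFunction n ⊕ Empty))
  have h2 : ∀ n, Countable ((starLang Γ L).Relations n) := fun n =>
    inferInstanceAs (Countable (Γ.TreeRelation n ⊕ HatRelation Γ L n))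
  exact inferInstanceAs (Countable ((Σ n, (starLang Γ L).Functions n) ⊕
    (Σ n, (starLang Γ L).Relations n)))

/-! #### The glued structure is a NIC structure -/

theorem root_mem_tcl (B : Set (Γ.Node S)) : Node.root ∈ tcl B :=
  Set.mem_iUnion.2 ⟨0, Or.inl rfl⟩

theorem mem_tcl_of_le {B : Set (Γ.Node S)} {a b : Γ.Node S} (hb : b ∈ B) (h : a ≤ b) :
    a ∈ tcl B :=
  Set.mem_iUnion.2 ⟨0, Or.inr ⟨b, hb, h⟩⟩

theorem mem_tcl_of_pred {B : Set (Γ.Node S)} {a : Γ.Node S} (ha : a.proj ∉ Γ.infNodes)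
    (h : a.pred ∈ tcl B) : a ∈ tcl B := by
  obtain ⟨n, hn⟩ := Set.mem_iUnion.1 h
  exact Set.mem_iUnion.2 ⟨n + 1, Or.inr ⟨ha, hn⟩⟩

/-- A `⋆`-node outside the closure has its predecessor outside as well. The descent from `a` must
stop at a node of an infinite component, since the root is in the closure. -/
theorem exists_minimal_notMem_tcl {B : Set (Γ.Node S)} {a : Γ.Node S} (ha : a ∉ tcl B) :
    ∃ a₀ ≤ a, a₀ ∉ tcl B ∧ a₀.proj ∈ Γ.infNodes := by
  generalize hτ : a.proj = τ
  induction τ using List.reverseRecOn generalizing a with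
  | nil => exact absurd (Node.eq_root_of_proj hτ ▸ root_mem_tcl B) ha
  | append_singleton τ k ih =>
    by_cases hinf : a.proj ∈ Γ.infNodes
    · exact ⟨a, List.prefix_refl a.1, ha, hinf⟩
    · have hp : a.pred ∉ tcl B := fun h => ha (mem_tcl_of_pred hinf h)
      obtain ⟨a₀, h1, h2⟩ := ih hp (by rw [Node.proj_pred, hτ, List.dropLast_concat])
      exact ⟨a₀, List.IsPrefix.trans h1 (List.dropLast_prefix a.1), h2⟩

variable {N : Γ.infNodes → Type w} [∀ σ, (L σ).Structure (N σ)] {f : ∀ σ, S ≃ N σ}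
  [(starLang Γ L).Structure (Γ.Node S)]

/-- The values of the terms `pred^m x_i` form a finite set closed under predecessors, and atomic
formulas in these terms express exactly the conditions of `exists_aut_extending`. -/
theorem IsGlued.exists_aut_of_qf (hM : IsGlued L N f)
    (hN : ∀ σ, NIC.IsHomogeneous (L σ) (N σ)) {n : ℕ} {a a' : Fin n → Γ.Node S}
    (h : ∀ ψ : (starLang Γ L).Formula (Fin n), BoundedFormula.IsQF ψ →
      (ψ.Realize a ↔ ψ.Realize a')) :
    ∃ e : Γ.Node S ≃[starLang Γ L] Γ.Node S, e ∘ a = a' := by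
  let t : Fin n × Fin (Γ.height + 1) → (starLang Γ L).Term (Fin n) := fun j =>
    (predTerm L)^[j.2.1] (Term.var j.1)
  have ht : ∀ j (b : Fin n → Γ.Node S), (t j).realize b = Node.pred^[j.2.1] (b j.1) := by
    intro j b
    rw [realize_predTerm_iterate, hM.kpred_iterate]
    rfl
  let q : Fin n × Fin (Γ.height + 1) → Γ.Node S × Γ.Node S := fun j =>
    ((t j).realize a, (t j).realize a')
  have hroot : ∀ m x, Γ.height ≤ m → Node.pred^[m] x = (Node.root : Γ.Node S) := by
    intro m x hm
    ext1
    rw [Node.pred_iterate_val, Nat.sub_eq_zero_of_le ((length_le_height x).trans hm)]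
    rfl
  suffices hQ : ∃ e : Γ.Node S ≃[starLang Γ L] Γ.Node S, ∀ x ∈ Set.range q, e x.1 = x.2 by
    obtain ⟨e, he⟩ := hQ
    refine ⟨e, funext fun i => ?_⟩
    have := he _ ⟨(i, 0), rfl⟩
    simpa [q, t] using this
  refine hM.exists_aut_extending hN (Set.finite_range q) ?_ ?_ ?_ ?_
  · rintro _ ⟨⟨i, m⟩, rfl⟩
    have hm := m.2
    -- At exponent `Γ.height` the root is reached, so the exponent can be capped there.
    refine ⟨(i, ⟨min (m.1 + 1) Γ.height, by omega⟩), ?_⟩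
    have : ∀ x : Γ.Node S, Node.pred^[min (m.1 + 1) Γ.height] x = (Node.pred^[m.1] x).pred := by
      intro x
      rw [← Function.iterate_succ_apply' Node.pred]
      by_cases hm' : m.1 + 1 ≤ Γ.height
      · rw [min_eq_left hm']
      · rw [min_eq_right (by omega), hroot _ _ le_rfl, hroot _ _ (by omega)]
    simp only [q, ht, this]
  · rintro _ ⟨j, rfl⟩
    have := h (projFormula L ⟨_, ((t j).realize a).proj_mem⟩ (t j))
      (BoundedFormula.IsAtomic.rel _ _).isQF
    rw [realize_projFormula, realize_projFormula, hM.kproj_iff, hM.kproj_iff] at this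
    exact (this.1 rfl).symm
  · rintro _ ⟨j, rfl⟩ _ ⟨j', rfl⟩
    have := h ((t j).equal (t j')) (BoundedFormula.IsAtomic.equal _ _).isQF
    rwa [Formula.realize_equal, Formula.realize_equal] at this
  · intro σ m R x hx
    choose j hj using hx
    obtain rfl : (fun i => q (j i)) = x := funext hj
    have := h ((hatSymb L σ R).formula fun i => t (j i)) (BoundedFormula.IsAtomic.rel _ _).isQF
    rwa [realize_hatFormula, realize_hatFormula] at this

theorem IsGlued.categorical [∀ σ, (L σ).IsRelational] [Countable S] [Infinite S]
    (hM : IsGlued L N f) (T : ∀ σ, (L σ).Theory) [∀ σ, N σ ⊨ T σ]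
    (hcat : ∀ σ, Cardinal.Categorical (Cardinal.aleph0.{w}) (T σ)) :
    Cardinal.Categorical (Cardinal.aleph0.{w}) ((starLang Γ L).completeTheory (Γ.Node S)) := by
  intro K K' hK hK'
  have key : ∀ K : ((starLang Γ L).completeTheory (Γ.Node S)).ModelType,
      Cardinal.mk K = Cardinal.aleph0 → Nonempty (Γ.Node S ≃[starLang Γ L] K) := by
    intro K hK
    have : Countable K := Cardinal.mk_le_aleph0_iff.1 hK.le
    refine hM.nonempty_equiv T hcat ?_
    rw [elementarilyEquivalent_iff]
    exact fun χ => (realize_iff_of_model_completeTheory (Γ.Node S) K χ).symm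
  obtain ⟨e⟩ := key K hK
  obtain ⟨e'⟩ := key K' hK'
  exact ⟨e'.comp e.symm⟩

theorem IsGlued.eliminatesQuantifiers [∀ σ, (L σ).IsRelational] [∀ σ, Countable (L σ).Symbols]
    [Countable S] [Infinite S]
    (hM : IsGlued L N f) (T : ∀ σ, (L σ).Theory) [∀ σ, N σ ⊨ T σ]
    (hcat : ∀ σ, Cardinal.Categorical (Cardinal.aleph0.{w}) (T σ))
    (hN : ∀ σ, NIC.IsHomogeneous (L σ) (N σ)) :
    NIC.EliminatesQuantifiers ((starLang Γ L).completeTheory (Γ.Node S)) := by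
  apply NIC.eliminatesQuantifiers_of_countable
  intro K _ _ hK n a a' haa φ hφ
  obtain ⟨g⟩ := hM.nonempty_equiv T hcat hK
  have hg : ∀ (ψ : (starLang Γ L).Formula (Fin n)) (c : Fin n → K),
      ψ.Realize (g.symm ∘ c) ↔ ψ.Realize c := fun ψ c => StrongHomClass.realize_formula g.symm ψ
  obtain ⟨e, he⟩ := hM.exists_aut_of_qf hN (a := g.symm ∘ a) (a' := g.symm ∘ a') fun ψ hψ => by
    rw [hg, hg]
    exact haa ψ hψ
  rw [← hg, ← he, StrongHomClass.realize_formula, hg]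
  exact hφ

/-- The elements of the closure are even definable over `B`: the root by its predicate, initial
segments as iterated predecessors, and a `⋆`-child as the only child of its projection. -/
theorem IsGlued.tcl_subset_acl (hM : IsGlued L N f) (B : Set (Γ.Node S)) :
    tcl B ⊆ NIC.acl (starLang Γ L) B := by
  suffices h : ∀ x ∈ tcl B, B.Definable₁ (starLang Γ L) {x} from
    fun x hx => ⟨{x}, h x hx, Set.finite_singleton x, rfl⟩
  have hstage : ∀ n, ∀ x ∈ tclStage B n, B.Definable₁ (starLang Γ L) {x} := by
    intro n
    induction n with
    | zero =>
      rintro x (hx | ⟨b, hb, hxb⟩)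
      · obtain rfl : x = Node.root := hx
        rw [Set.Definable₁, Set.definable_iff_exists_formula_sum]
        refine ⟨projFormula L ⟨[], Γ.nil_mem⟩ (Term.var (Sum.inr 0)), ?_⟩
        ext v
        rw [Set.mem_ofPred_eq, Set.mem_ofPred_eq, realize_projFormula, hM.kproj_iff]
        exact ⟨fun h => by rw [Set.mem_singleton_iff] at h; simp [h]; rfl,
          fun h => Node.eq_root_of_proj h⟩
      · obtain ⟨m, -, rfl⟩ := Node.le_iff_exists_pred.1 hxb
        refine NIC.definable_singleton_of_formula (Set.Definable.singleton_of_mem _ hb)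
          ((Term.var 1).equal ((predTerm L)^[m] (Term.var 0))) fun z => ?_
        rw [Formula.realize_equal, realize_predTerm_iterate, hM.kpred_iterate]
        rfl
    | succ n ih =>
      rintro x (hx | ⟨hx, hx'⟩)
      · exact ih x hx
      · refine NIC.definable_singleton_of_formula (ih _ hx')
          (((predTerm L (Term.var 1)).equal (Term.var 0)) ⊓
            projFormula L ⟨_, x.proj_mem⟩ (Term.var 1)) fun z => ?_
        rw [Formula.realize_inf, Formula.realize_equal, realize_projFormula, realize_predTerm,
          hM.kproj_iff, hM.kpred_eq]
        constructor
        · rintro ⟨h1, h2⟩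
          refine hM.isTree.star_unique hx ((hM.kproj_iff _ _).2 h2) ((hM.kproj_iff _ _).2 rfl) ?_
          rw [hM.kpred_eq, hM.kpred_eq]
          exact h1
        · rintro rfl
          exact ⟨rfl, rfl⟩
  intro x hx
  obtain ⟨n, hn⟩ := Set.mem_iUnion.1 hx
  exact hstage n x hn

/-- The finite set of elements of `N_σ` that correspond to children of `b` below an element
of `A`. -/
theorem finite_trace (f : ∀ σ, S ≃ N σ) {A : Set (Γ.Node S)} (hA : A.Finite)
    (l : List (ℕ × Option S)) (k : ℕ) (σ : Γ.infNodes) :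
    {z : N σ | ∃ c ∈ A, l ++ [(k, some ((f σ).symm z))] <+: c.1}.Finite := by
  have : {z : N σ | ∃ c ∈ A, l ++ [(k, some ((f σ).symm z))] <+: c.1} =
      ⋃ c ∈ A, {z : N σ | l ++ [(k, some ((f σ).symm z))] <+: c.1} := by
    ext z
    simp
  rw [this]
  refine hA.biUnion fun c _ => Set.Subsingleton.finite ?_
  intro z hz z' hz'
  have := List.prefix_of_prefix_length_le hz hz' (by simp)
  have := this.eq_of_length (by simp)
  simpa using this

/-- Let `D` be definable over a finite `A ⊆ B` and contain `a ∉ tcl B`. Some `a₀ ≤ a` in an infinite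
component lies below no element of `A`. An automorphism of that component fixes all members below
`A` and moves `a₀` to a member below no element of the finite set `D`. Its extension fixes `A`,
hence preserves `D`, yet sends `a` out of `D`. -/
theorem IsGlued.acl_subset_tcl [∀ σ, (L σ).IsRelational] [Infinite S]
    (hM : IsGlued L N f) (T : ∀ σ, (L σ).Theory) [∀ σ, N σ ⊨ T σ]
    (hqe : ∀ σ, NIC.EliminatesQuantifiers (T σ))
    (hext : ∀ σ, NIC.ExtensionProperty (L σ) (N σ))
    (hN : ∀ σ, NIC.IsHomogeneous (L σ) (N σ)) (B : Set (Γ.Node S)) :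
    NIC.acl (starLang Γ L) B ⊆ tcl B := by
  rintro a ⟨D, hD, hDfin, haD⟩
  by_contra ha
  obtain ⟨A, hAB, hDA⟩ := Set.definable_iff_finitely_definable.1 hD
  obtain ⟨a₀, haa, ha₀, hinf⟩ := exists_minimal_notMem_tcl ha
  obtain ⟨k, hk⟩ := exists_eq_dropLast_append ⟨a₀.proj, hinf⟩
  obtain ⟨s₀, hs₀⟩ := Node.exists_eq_concat_some hk hinf
  let σ : Γ.infNodes := ⟨a₀.proj, hinf⟩
  have hσ : σ.1 = a₀.pred.proj ++ [k] := by rw [Node.proj_pred]; exact hk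
  have : Nonempty (N σ) := (f σ).nonempty_congr.1 inferInstance
  let A' : Set (N σ) := {z | ∃ c ∈ (A : Set (Γ.Node S)),
    a₀.pred.1 ++ [(k, some ((f σ).symm z))] <+: c.1}
  have hA' : A'.Finite := finite_trace f A.finite_toSet _ _ _
  have hE := finite_trace f hDfin a₀.pred.1 k σ
  have hpfin : {z : N σ × N σ | z.1 ∈ A' ∧ z.2 = z.1}.Finite := by
    refine (hA'.image fun z => (z, z)).subset ?_
    rintro ⟨z, z'⟩ ⟨hz, hz'⟩
    exact ⟨z, hz, Prod.ext rfl hz'.symm⟩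
  obtain ⟨d, hd, hp⟩ := (NIC.IsPartialIso.refl (L := L σ) A').exists_insert (hqe σ) (hext σ)
    hpfin (c := f σ s₀) (by
      rintro d ⟨⟨c, hc, hc'⟩, -⟩
      refine ha₀ (mem_tcl_of_le (hAB hc) ?_)
      rw [Equiv.symm_apply_apply, ← hs₀] at hc'
      exact hc') hE.toFinset
  obtain ⟨g, hg⟩ := hN σ _ (hpfin.insert _) hp
  obtain ⟨e, he1, he2⟩ := hM.exists_aut_component hσ g
  have hfix : ∀ c ∈ (A : Set (Γ.Node S)), e c = c := by
    intro c hc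
    refine he1 c fun s hs => hg (f σ s, f σ s) (Or.inr ⟨⟨c, hc, ?_⟩, rfl⟩)
    rwa [Equiv.symm_apply_apply]
  have heD : e a ∈ D := (NIC.mem_iff_of_definable e hfix hDA fun _ => a).1 haD
  apply hd
  rw [Set.Finite.mem_toFinset]
  refine ⟨e a, heD, ?_⟩
  have h1 : a₀.pred.1 ++ [(k, some s₀)] <+: a.1 := by
    rw [← hs₀]
    exact haa
  have := he2 a s₀ h1
  rwa [hg (f σ s₀, d) (Set.mem_insert _ _)] at this

end TreePlan

/-! ### Conjugacy of nodes and the conditions N2 and N3. -/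

namespace TreePlan

open FirstOrder FirstOrder.Language

variable {Γ : TreePlan} {S : Type w} {L : Γ.infNodes → FirstOrder.Language.{u, v}}
  {N : Γ.infNodes → Type w} [∀ σ, (L σ).Structure (N σ)] {f : ∀ σ, S ≃ N σ}

theorem proj_eq_of_realizes {e e' : Γ.Node S}
    (h : NIC.Realizes (NIC.tp Γ.lang ∅ e) e') : e'.proj = e.proj := by
  let R : Γ.lang.Relations 1 := TreeRelation.P ⟨e.proj, e.proj_mem⟩
  have hR : ∀ x : Γ.Node S, ((Γ.lang.lhomWithConstants (∅ : Set (Γ.Node S))).onFormula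
      (R.formula₁ (Term.var (0 : Fin 1)))).Realize (fun _ => x) ↔ x.proj = e.proj := by
    intro x
    rw [LHom.realize_onFormula, Formula.realize_rel₁]
    rfl
  exact (hR e').1 (h _ ((hR e).2 rfl))

variable [(starLang Γ L).Structure (Γ.Node S)]

/-- Nodes with the same projection are conjugate under automorphisms. -/
theorem IsGlued.exists_aut_of_proj_eq (hM : IsGlued L N f) (T : ∀ σ, (L σ).Theory)
    [∀ σ, N σ ⊨ T σ] (hone : ∀ σ, Nat.card ((T σ).CompleteType (Fin 1)) = 1)
    (hN : ∀ σ, NIC.IsHomogeneous (L σ) (N σ)) {a a' : Γ.Node S} (h : a'.proj = a.proj) :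
    ∃ e : Γ.Node S ≃[starLang Γ L] Γ.Node S, e a = a' := by
  have hlen : a'.1.length = a.1.length := by rw [← Node.length_proj, h, Node.length_proj]
  have hproj : ∀ m, (Node.pred^[m] a').proj = (Node.pred^[m] a).proj := by
    intro m
    induction m with
    | zero => exact h
    | succ m ih => rw [Function.iterate_succ_apply', Function.iterate_succ_apply',
        Node.proj_pred, Node.proj_pred, ih]
  have hlt : ∀ (c : Γ.Node S) (m m' : ℕ), Node.pred^[m] c = Node.pred^[m'] c ↔
      c.1.length - m = c.1.length - m' := by
    intro c m m'
    refine ⟨fun hc => ?_, fun hc => Node.ext ?_⟩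
    · have := congrArg (fun x : Γ.Node S => x.1.length) hc
      simp only [Node.pred_iterate_val, List.length_take] at this
      omega
    · rw [Node.pred_iterate_val, Node.pred_iterate_val, hc]
  -- The finite map pairs the initial segments of `a` with those of `a'`.
  let q : ℕ → Γ.Node S × Γ.Node S := fun m => (Node.pred^[m] a, Node.pred^[m] a')
  have hfin : (Set.range q).Finite := by
    refine ((Set.finite_Iic a.1.length).image q).subset ?_
    rintro _ ⟨m, rfl⟩
    refine ⟨min m a.1.length, Set.mem_Iic.2 (min_le_right _ _), Prod.ext ((hlt _ _ _).2 ?_) ((hlt _ _ _).2 ?_)⟩ <;>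
      omega
  suffices hQ : ∃ e : Γ.Node S ≃[starLang Γ L] Γ.Node S, ∀ x ∈ Set.range q, e x.1 = x.2 by
    obtain ⟨e, he⟩ := hQ
    exact ⟨e, he _ ⟨0, rfl⟩⟩
  refine hM.exists_aut_extending hN hfin ?_ ?_ ?_ ?_
  · rintro _ ⟨m, rfl⟩
    exact ⟨m + 1, by simp only [q, Function.iterate_succ_apply']⟩
  · rintro _ ⟨m, rfl⟩
    exact (hproj m).symm
  · rintro _ ⟨m, rfl⟩ _ ⟨m', rfl⟩
    rw [hlt, hlt, hlen]
  · intro σ n R x hx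
    choose j hj using hx
    obtain rfl : (fun i => q (j i)) = x := funext hj
    have hcons : ∀ c : Γ.Node S, (fun i : Fin (n + 1) => Node.pred^[j i] c) =
        Fin.cons (Node.pred^[j 0] c) fun i => Node.pred^[j i.succ] c := by
      intro c
      funext i
      exact Fin.cases rfl (fun _ => rfl) i
    have key : ∀ c c' : Γ.Node S, c'.proj = c.proj → c'.1.length = c.1.length →
        (∀ m, (Node.pred^[m] c').proj = (Node.pred^[m] c).proj) →
        khat L σ R (fun i => Node.pred^[j i] c) → khat L σ R (fun i => Node.pred^[j i] c') := by
      intro c c' hc hl hm hR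
      obtain ⟨k, s, hσ, hs, hRs⟩ := (hM.khat_iff σ n R _).1 hR
      have hpred : ∀ i : Fin n, Node.pred^[j 0] c = Node.pred^[j i.succ + 1] c := by
        intro i
        rw [Function.iterate_succ_apply']
        exact (Node.pred_concat (hs i)).symm
      have hpred' : ∀ i : Fin n, Node.pred^[j 0] c' = (Node.pred^[j i.succ] c').pred := by
        intro i
        rw [← Function.iterate_succ_apply' Node.pred, hlt, hl, ← hlt]
        exact hpred i
      have hproj' : ∀ i : Fin n, (Node.pred^[j i.succ] c').proj =
          (Node.pred^[j 0] c').proj ++ [k] := by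
        intro i
        rw [hm, hm, Node.proj_concat (hs i)]
      have hs' : ∀ i : Fin n, ∃ s' : S,
          (Node.pred^[j i.succ] c').1 = (Node.pred^[j 0] c').1 ++ [(k, some s')] := by
        intro i
        rw [hpred' i]
        refine Node.exists_eq_concat_some (hproj' i) ?_
        rw [hproj' i, hm, ← hσ]
        exact σ.2
      choose s' hs' using hs'
      rw [hcons c', hM.khat_concat (by rw [hm]; exact hσ) R hs']
      have hconst : ∀ (d : Γ.Node S) (r : Fin n → S),
          (∀ i : Fin n, ∀ i' : Fin n, Node.pred^[j i.succ] d = Node.pred^[j i'.succ] d) →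
          (∀ i : Fin n, (Node.pred^[j i.succ] d).1 = (Node.pred^[j 0] d).1 ++ [(k, some (r i))]) →
          ∀ i i', r i = r i' := by
        intro d r hd hr i i'
        have := congrArg Subtype.val (hd i i')
        rw [hr, hr] at this
        simpa using this
      -- A chain contains at most one child of a given node, so a related tuple is constant after
      -- its first entry and the single 1-type settles the relation.
      have hall : ∀ i i' : Fin n, Node.pred^[j i.succ] c = Node.pred^[j i'.succ] c := by
        intro i i'
        rw [hlt]
        have h1 := congrArg List.length (hs i)
        have h2 := congrArg List.length (hs i')
        simp only [Node.pred_iterate_val, List.length_take, List.length_append,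
          List.length_singleton] at h1 h2
        omega
      have hall' : ∀ i i' : Fin n, Node.pred^[j i.succ] c' = Node.pred^[j i'.succ] c' := by
        intro i i'
        rw [hlt, hl, ← hlt]
        exact hall i i'
      have h1 := hconst c s hall hs
      have h2 := hconst c' s' hall' hs'
      cases n with
      | zero =>
        convert hRs using 2
      | succ n =>
        have : Nonempty (N σ) := ⟨f σ (s 0)⟩
        have hp := (NIC.isPartialIso_singleton (hone σ) (f σ (s 0)) (f σ (s' 0))).2 _ R
          (fun _ => (f σ (s 0), f σ (s' 0))) fun _ => rfl
        have e1 : (fun i => f σ (s i)) = fun _ => f σ (s 0) := funext fun i => by rw [h1 i 0]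
        have e2 : (fun i => f σ (s' i)) = fun _ => f σ (s' 0) := funext fun i => by rw [h2 i 0]
        rw [e1] at hRs
        rw [e2]
        exact hp.1 hRs
    exact ⟨key a a' h hlen hproj, key a' a h.symm hlen.symm fun m => (hproj m).symm⟩

/-- The full type of `(pred e, e, c)` is itself a relation symbol `R_p` of the component structure.
That `R_p` holds at `(e, c)` is a formula with parameters in the closure of `C`, so it holds at
`(e', c)` too. -/
theorem realize_iff_of_realizes_component (L' : FirstOrder.Language.{u, v})
    [L'.Structure (Γ.Node S)] {C : Set (Γ.Node S)} {e : Γ.Node S} {e' : component e}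
    (h : NIC.Realizes (NIC.tp (componentLang Γ S L' e.proj)
        {x : component e | x.1 ∈ tcl C} ⟨e, self_mem_component e⟩) e')
    {m : ℕ} (c : Fin m → Γ.Node S) (hc : ∀ i, c i ∈ component e) (hC : ∀ i, c i ∈ tcl C)
    (φ : L'.Formula (Fin (m + 2))) :
    φ.Realize (Fin.cons e.pred (Fin.cons e c : Fin (m + 1) → Γ.Node S) :
        Fin (m + 2) → Γ.Node S) ↔
      φ.Realize (Fin.cons e.pred (Fin.cons e'.1 c : Fin (m + 1) → Γ.Node S) :
        Fin (m + 2) → Γ.Node S) := by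
  let A : Set (component e) := {x : component e | x.1 ∈ tcl C}
  let α : Γ.Node S → Fin (m + 1) → Γ.Node S := fun x => Fin.cons x c
  let p := Theory.typeOf (L'.completeTheory (Γ.Node S))
    (Fin.cons e.pred (α e) : Fin (m + 2) → Γ.Node S)
  have hp : p ∈ componentTypes (Γ := Γ) (S := S) L' e.proj (m + 1) := by
    refine ⟨m.succ_pos, α e, rfl, fun i => ?_, rfl⟩
    refine Fin.cases (self_mem_component e) (fun i => hc i) i
  let R : (componentLang Γ S L' e.proj).Relations (m + 1) := ⟨p, hp⟩
  let ψ : (componentLang Γ S L' e.proj)[[A]].Formula (Fin 1) :=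
    Relations.formula (Sum.inl R : (componentLang Γ S L' e.proj)[[A]].Relations (m + 1))
      (Fin.cons (Term.var 0) fun i =>
        ((componentLang Γ S L' e.proj).con (⟨⟨c i, hc i⟩, hC i⟩ : A)).term)
  have hψ : ∀ x : component e, ψ.Realize (fun _ => x) ↔
      Theory.typeOf (L'.completeTheory (Γ.Node S))
        (Fin.cons e.pred (α x.1) : Fin (m + 2) → Γ.Node S) = p := by
    intro x
    have e1 : (fun i => ((Fin.cons (Term.var 0) fun i =>
        ((componentLang Γ S L' e.proj).con (⟨⟨c i, hc i⟩, hC i⟩ : A)).term :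
          Fin (m + 1) → (componentLang Γ S L' e.proj)[[A]].Term (Fin 1)) i).realize fun _ => x) =
        (Fin.cons x fun i => ⟨c i, hc i⟩ : Fin (m + 1) → component e) := by
      funext i
      refine Fin.cases rfl (fun i => rfl) i
    have e2 : (fun i => ((Fin.cons x fun i => ⟨c i, hc i⟩ : Fin (m + 1) → component e) i :
        Γ.Node S)) = α x.1 := by
      funext i
      refine Fin.cases rfl (fun i => rfl) i
    refine Formula.realize_rel.trans ?_
    rw [e1, withConstants_relMap_sumInl, ← e2]
    rfl
  have := (hψ e').1 (h ψ ((hψ _).2 rfl))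
  rw [← Theory.CompleteType.formula_mem_typeOf (T := L'.completeTheory (Γ.Node S)),
    ← Theory.CompleteType.formula_mem_typeOf (T := L'.completeTheory (Γ.Node S))]
  change _ ↔ _ ∈ Theory.typeOf (L'.completeTheory (Γ.Node S))
    (Fin.cons e.pred (α e'.1) : Fin (m + 2) → Γ.Node S)
  rw [this]

/-- Only the finitely many siblings of `e` below elements of `C` matter, and they lie in `tcl C`.
The map that fixes them and sends `e` to `e'` is a partial isomorphism of `N σ`; an automorphism
extending it is applied to this component alone. -/
theorem IsGlued.exists_aut_of_realizes_component (hM : IsGlued L N f)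
    (hN : ∀ σ, NIC.IsHomogeneous (L σ) (N σ)) {C : Set (Γ.Node S)} (hC : C.Finite)
    {e : Γ.Node S} (he : e.proj ∈ Γ.infNodes) {e' : component e}
    (h : NIC.Realizes (NIC.tp (componentLang Γ S (starLang Γ L) e.proj)
        {x : component e | x.1 ∈ tcl C} ⟨e, self_mem_component e⟩) e') :
    ∃ g : Γ.Node S ≃[starLang Γ L] Γ.Node S, (∀ c ∈ C, g c = c) ∧ g e = e'.1 := by
  obtain ⟨k, hk⟩ := exists_eq_dropLast_append ⟨e.proj, he⟩
  have hσ : e.proj = e.pred.proj ++ [k] := by rw [Node.proj_pred]; exact hk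
  let σ : Γ.infNodes := ⟨e.proj, he⟩
  have hsn : e.pred.proj ++ [k] ∈ Γ.infNodes := hσ ▸ he
  obtain ⟨s₀, hs₀⟩ := Node.exists_eq_concat_some hk he
  obtain ⟨s₁, hs₁⟩ := Node.exists_eq_concat_some (e'.2.2.trans hk) (e'.2.2 ▸ he)
  rw [e'.2.1] at hs₁
  let A : Set (N σ) := {z | ∃ c ∈ C, e.pred.1 ++ [(k, some ((f σ).symm z))] <+: c.1}
  have hA : A.Finite := finite_trace f hC _ _ _
  have : Finite A := hA
  obtain ⟨m, ⟨a⟩⟩ := Finite.exists_equiv_fin A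
  let r : Fin m → S := fun i => (f σ).symm (a.symm i).1
  let c : Fin m → Γ.Node S := fun i => e.pred.snoc k hsn (r i)
  have hc : ∀ i, c i ∈ component e := fun i =>
    ⟨Node.pred_concat rfl, (Node.proj_concat rfl).trans hσ.symm⟩
  have hcC : ∀ i, c i ∈ tcl C := by
    intro i
    obtain ⟨d, hd, hd'⟩ := (a.symm i).2
    exact mem_tcl_of_le hd hd'
  have key : ∀ φ : (starLang Γ L).Formula (Fin (m + 2)), _ ↔ _ :=
    realize_iff_of_realizes_component (starLang Γ L) h c hc hcC
  let t : S → Fin (m + 1) → S := fun s => Fin.cons s r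
  have hx : ∀ (y : Γ.Node S) (s : S), y.1 = e.pred.1 ++ [(k, some s)] → ∀ i,
      ((Fin.cons y c : Fin (m + 1) → Γ.Node S) i).1 = e.pred.1 ++ [(k, some (t s i))] := by
    intro y s hy i
    exact Fin.cases hy (fun i => rfl) i
  have heq : ∀ (y : Γ.Node S) (s : S), y.1 = e.pred.1 ++ [(k, some s)] → ∀ i j,
      ((Fin.cons y c : Fin (m + 1) → Γ.Node S) i = (Fin.cons y c : Fin (m + 1) → Γ.Node S) j ↔
        t s i = t s j) := by
    intro y s hy i j
    refine ⟨fun hij => ?_, fun hij => Node.ext (by rw [hx y s hy, hx y s hy, hij])⟩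
    have := congrArg Subtype.val hij
    rw [hx y s hy, hx y s hy] at this
    simpa using this
  let q : Fin (m + 1) → N σ × N σ := fun i => (f σ (t s₀ i), f σ (t s₁ i))
  have hq : NIC.IsPartialIso (L σ) (Set.range q) := by
    constructor
    · rintro _ ⟨i, rfl⟩ _ ⟨j, rfl⟩
      -- Variable 0 stands for `pred e`, so the members of the component have shifted indices.
      have := key ((Term.var i.succ).equal (Term.var j.succ))
      rw [Formula.realize_equal, Formula.realize_equal] at this
      simp only [Term.realize_var, Fin.cons_succ] at this
      rw [heq _ _ hs₀, heq _ _ hs₁] at this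
      simpa [q] using this
    · intro n R y hy
      choose j hj using hy
      obtain rfl : (fun i => q (j i)) = y := funext hj
      have := key ((hatSymb L σ R).formula
        (Fin.cons (Term.var 0) fun i => Term.var (j i).succ))
      rw [realize_hatFormula, realize_hatFormula] at this
      have hcons : ∀ y : Γ.Node S, (fun i => ((Fin.cons (Term.var 0) fun i =>
          Term.var (j i).succ : Fin (n + 1) → (starLang Γ L).Term (Fin (m + 2))) i).realize
            (Fin.cons e.pred (Fin.cons y c : Fin (m + 1) → Γ.Node S) : Fin (m + 2) → Γ.Node S)) =
          (Fin.cons e.pred fun i => (Fin.cons y c : Fin (m + 1) → Γ.Node S) (j i) :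
            Fin (n + 1) → Γ.Node S) := by
        intro y
        funext i
        exact Fin.cases rfl (fun i => rfl) i
      rw [hcons, hcons, hM.khat_concat hσ R fun i => hx _ _ hs₀ (j i),
        hM.khat_concat hσ R fun i => hx _ _ hs₁ (j i)] at this
      exact this
  obtain ⟨g, hg⟩ := hN σ _ (Set.finite_range q) hq
  obtain ⟨G, hG1, hG2⟩ := hM.exists_aut_component hσ g
  refine ⟨G, fun d hd => hG1 d fun s hs => ?_, ?_⟩
  · have hsA : f σ s ∈ A := ⟨d, hd, by rwa [Equiv.symm_apply_apply]⟩
    have := hg (q (a ⟨_, hsA⟩).succ) ⟨_, rfl⟩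
    simpa [q, t, r] using this
  · have h1 := hG2 e s₀ (by rw [← hs₀])
    have h2 : g (f σ s₀) = f σ s₁ := hg (q 0) ⟨0, rfl⟩
    rw [h2, Equiv.symm_apply_apply, ← hs₁] at h1
    -- The image of `e` extends `e'`, and both have the length of the common projection.
    refine Node.ext (h1.eq_of_length ?_).symm
    rw [← Node.length_proj, ← Node.length_proj, hM.proj_map, e'.2.2]

end TreePlan

/-! ### Assembly of the conditions N1, N2 and N3. -/

theorem mainTheorem3 (Γ : TreePlan) (S : Type w) [Countable S] [Infinite S]
    (L : Γ.infNodes → FirstOrder.Language.{u, v}) [∀ σ, (L σ).IsRelational]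
    [∀ σ, Countable (L σ).Symbols]
    (T : ∀ σ, (L σ).Theory)
    (hcat : ∀ σ, Cardinal.Categorical (Cardinal.aleph0.{w}) (T σ))
    (hacl : ∀ σ, NIC.AlgebraicallyTrivial.{u, v, w} (T σ))
    (hqe : ∀ σ, NIC.EliminatesQuantifiers (T σ))
    (hone : ∀ σ, Nat.card ((T σ).CompleteType (Fin 1)) = 1)
    (N : Γ.infNodes → Type w) [∀ σ, (L σ).Structure (N σ)] [∀ σ, (N σ) ⊨ (T σ)]
    (f : ∀ σ, S ≃ N σ) :
    TreePlan.IsNIC (S := S) (FirstOrder.Language.LHom.sumInl : Γ.lang →ᴸ TreePlan.starLang Γ L)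
      (TreePlan.gluedStructure L N f) := by
  have hc : ∀ σ, Countable (N σ) := fun σ => (f σ).symm.injective.countable
  have hi : ∀ σ, Infinite (N σ) := fun σ => Infinite.of_injective (f σ) (f σ).injective
  have hext : ∀ σ, NIC.ExtensionProperty (L σ) (N σ) := fun σ =>
    NIC.extensionProperty_of_categorical (hcat σ) (hacl σ) (N σ)
  have hN : ∀ σ, NIC.IsHomogeneous (L σ) (N σ) := fun σ p hp h =>
    h.exists_equiv (hqe σ) (hext σ) hp
  let := TreePlan.hatStructure L N f
  let := TreePlan.gluedStructure L N f
  have hM := TreePlan.isGlued_gluedStructure L N f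
  exact {
    injective := FirstOrder.Language.LHom.sumInl_injective
    isExpansion := FirstOrder.Language.LHom.sumInl_isExpansionOn _
    categorical := hM.categorical T hcat
    eliminatesQuantifiers := hM.eliminatesQuantifiers T hcat hN
    acl_eq_tcl := fun B =>
      (hM.acl_subset_tcl T hqe hext hN B).antisymm (hM.tcl_subset_acl B)
    n2 := by
      intro e e' h
      obtain ⟨g, rfl⟩ := hM.exists_aut_of_proj_eq T hone hN (TreePlan.proj_eq_of_realizes h)
      exact NIC.realizes_tp_of_equiv g (fun _ ha => ha.elim) e
    n3 := by
      intro C hC e he e' _ h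
      obtain ⟨g, hg, hge⟩ := hM.exists_aut_of_realizes_component hN hC he h
      rw [← hge]
      exact NIC.realizes_tp_of_equiv g hg e }
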